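/- Let $E=(E^0,E^1,r,s)$ be a finite directed graph with no sinks (every vertex is the source of at least one edge), with adjacency matrix $A=(n_{v,w})_{v,w\in E^0}$, where $n_{v,w}$ is the number of edges with source $v$ and range $w$, and let $K$ be a field. Let $\mathcal L(E)=\mathcal L_K(E)$ be the Leavitt path algebra, i.e. the $K$-algebra (with identity $\sum_{v\in E^0}v$) generated by the symbols $v\in E^0$ and $\alpha,\alpha^*$ for $\alpha\in E^1$, subject to $vw=\delta_{v,w}v$; $s(\alpha)\alpha=\alpha r(\alpha)=\alpha$ and $r(\alpha)\alpha^*=\alpha^*s(\alpha)=\alpha^*$; $\alpha^*\beta=\delta_{\alpha,\beta}\,r(\alpha)$; and $\sum_{s(\alpha)=v}\alpha\alpha^*=v$ for every vertex $v$. It is $\mathbb Z$-graded by $\deg v=0$, $\deg\alpha=1$, $\deg\alpha^*=-1$. Let $K_0^{\mathrm{gr}}(\mathcal L(E))$ be the group completion of the monoid $\mathcal V^{\mathrm{gr}}(\mathcal L(E))$ of graded isomorphism classes $[P]$ of graded finitely generated projective right $\mathcal L(E)$-modules under direct sum, let $K_0^{\mathrm{gr}}(\mathcal L(E))^+$ be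 the image of $\mathcal V^{\mathrm{gr}}(\mathcal L(E))$ in it, and give it the $\mathbb Z[x,x^{-1}]$-module structure with $x[P]=[P(1)]$, where $P(1)_i=P_{i+1}$. For a square nonnegative integer matrix $B$ of size $n$, let $\Delta_B$ be the direct limit of $\mathbb Z^n\xrightarrow{B}\mathbb Z^n\xrightarrow{B}\cdots$ (Krieger's dimension group); write $[a,k]$ for the class of a vector $a$ in the $k$-th copy of $\mathbb Z^n$, let $\Delta_B^+=\{[a,k] : a\in\mathbb N^n,\ k\ge 0\}$, and let $\delta_B$ be the automorphism $[a,k]\mapsto[Ba,k]$ of $\Delta_B$. Then there is a group isomorphism $\phi:K_0^{\mathrm{gr}}(\mathcal L(E))\to\Delta_{A^t}$ such that $\phi(x\alpha)=\delta_{A^t}(\phi(\alpha))$ for all $\alpha\in K_0^{\mathrm{gr}}(\mathcal L(E))$, and $\phi\big(K_0^{\mathrm{gr}}(\mathcal L(E))^+\big)=\Delta_{A^t}^+$. -/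

import Mathlib

open scoped LaurentPolynomial DirectSum Matrix

universe u v w x y

/-! ### Graded right modules over a graded ring -/

section GradedModules

theorem isInternal_of_subsingleton {Γ : Type x} [DecidableEq Γ] {M : Type*} [AddCommGroup M]
    [Subsingleton M] (P : Γ → AddSubgroup M) : DirectSum.IsInternal P :=
  ⟨fun _ _ _ => DFinsupp.ext fun _ => Subsingleton.elim _ _,
    fun _ => ⟨0, Subsingleton.elim _ _⟩⟩

theorem coeAddMonoidHom_map_of_comm {Γ : Type x} [DecidableEq Γ] {M N : Type*} [AddCommGroup M] [AddCommGroup N]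
    {P : Γ → AddSubgroup M} {Q : Γ → AddSubgroup N} (F : M →+ N) (f : ∀ i, P i →+ Q i)
    (h : ∀ i (p : P i), (f i p : N) = F p) (z : ⨁ i, P i) :
    DirectSum.coeAddMonoidHom Q (DirectSum.map f z) = F (DirectSum.coeAddMonoidHom P z) := by
  have : (DirectSum.coeAddMonoidHom Q).comp (DirectSum.map f) =
      F.comp (DirectSum.coeAddMonoidHom P) := by
    refine DirectSum.addHom_ext fun i p => ?_
    simp [h]
  exact DFunLike.congr_fun this z

variable {Γ : Type x} [AddCommGroup Γ] [DecidableEq Γ]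
variable {A : Type u} [Ring A] {σ : Type y} [SetLike σ A] [AddSubgroupClass σ A]

/-- A `Γ`-graded right module over the `Γ`-graded ring `A = ⨁ 𝒜 γ`: a right `A`-module
(that is, a module over `Aᵐᵒᵖ`; `op a • m` is `m a`) which is the internal direct sum of additive
subgroups `M_γ` such that `M_i A_j ⊆ M_{i+j}`. -/
structure GrModule (𝒜 : Γ → σ) [GradedRing 𝒜] where
  carrier : Type u
  [addCommGroup : AddCommGroup carrier]
  [module : Module Aᵐᵒᵖ carrier]
  deg : Γ → AddSubgroup carrier
  isInternal : DirectSum.IsInternal deg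
  smul_mem : ∀ {i j : Γ} {m : carrier} {a : A},
    m ∈ deg i → a ∈ 𝒜 j → MulOpposite.op a • m ∈ deg (i + j)

attribute [instance] GrModule.addCommGroup GrModule.module

namespace GrModule

variable {𝒜 : Γ → σ} [GradedRing 𝒜]

/-- A homomorphism of graded modules: an `A`-linear map preserving degrees. -/
def IsGradedHom {M N : GrModule 𝒜} (f : M.carrier →ₗ[Aᵐᵒᵖ] N.carrier) : Prop :=
  ∀ (i : Γ) (m : M.carrier), m ∈ M.deg i → f m ∈ N.deg i

/-- Graded isomorphism: there is a bijective graded homomorphism. -/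
def IsIso (M N : GrModule 𝒜) : Prop :=
  ∃ e : M.carrier ≃ₗ[Aᵐᵒᵖ] N.carrier, IsGradedHom (M := M) (N := N) e.toLinearMap

/-- Finitely generated graded modules. -/
def IsFG (M : GrModule 𝒜) : Prop := Module.Finite Aᵐᵒᵖ M.carrier

/-- Graded projective modules: the projective objects of the category of graded right modules,
i.e. graded homomorphisms out of `P` lift along surjective graded homomorphisms. -/
def IsGradedProjective (P : GrModule 𝒜) : Prop :=
  ∀ (M N : GrModule 𝒜) (g : M.carrier →ₗ[Aᵐᵒᵖ] N.carrier) (j : P.carrier →ₗ[Aᵐᵒᵖ] N.carrier),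
    IsGradedHom g → Function.Surjective g → IsGradedHom j →
      ∃ h : P.carrier →ₗ[Aᵐᵒᵖ] M.carrier, IsGradedHom h ∧ g ∘ₗ h = j

theorem IsIso.refl (M : GrModule 𝒜) : IsIso M M :=
  ⟨LinearEquiv.refl _ _, fun _ _ h => h⟩

theorem isGradedHom_symm {M N : GrModule 𝒜} (e : M.carrier ≃ₗ[Aᵐᵒᵖ] N.carrier)
    (he : IsGradedHom (M := M) (N := N) e.toLinearMap) :
    IsGradedHom (M := N) (N := M) e.symm.toLinearMap := by
  intro i n hn
  obtain ⟨z, hz⟩ := M.isInternal.2 (e.symm n)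
  let f : ∀ k, M.deg k →+ N.deg k := fun k =>
    ((e : M.carrier →+ N.carrier).comp (M.deg k).subtype).codRestrict (N.deg k)
      fun p => he k p p.2
  have h1 := coeAddMonoidHom_map_of_comm (e : M.carrier →+ N.carrier) f (fun _ _ => rfl) z
  rw [hz] at h1
  have h2 : DirectSum.map f z = DirectSum.of (fun k => N.deg k) i ⟨n, hn⟩ := by
    apply N.isInternal.1
    rw [h1]
    simp
  have h3 : z = DirectSum.of (fun k => M.deg k) i (z i) := by
    ext k : 1
    by_cases hk : k = i
    · subst hk
      simp
    · rw [DirectSum.of_eq_of_ne _ _ _ hk]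
      have h4 := congrArg (fun t => (t k : N.carrier)) h2
      simp only [DirectSum.map_apply] at h4
      rw [DirectSum.of_eq_of_ne _ _ _ hk] at h4
      have h5 : e (z k : M.carrier) = 0 := h4
      exact Subtype.ext (by simpa using h5)
  have h6 : e.symm n = (z i : M.carrier) := by
    rw [← hz, h3]
    simp
  change e.symm n ∈ M.deg i
  rw [h6]
  exact (z i).2

theorem IsIso.symm {M N : GrModule 𝒜} : IsIso M N → IsIso N M := fun ⟨e, he⟩ =>
  ⟨e.symm, isGradedHom_symm e he⟩

theorem IsIso.trans {M N P : GrModule 𝒜} : IsIso M N → IsIso N P → IsIso M P :=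
  fun ⟨e, he⟩ ⟨f, hf⟩ => ⟨e.trans f, fun i m hm => hf i _ (he i m hm)⟩

/-- The zero graded module. -/
def zero (𝒜 : Γ → σ) [GradedRing 𝒜] : GrModule 𝒜 where
  carrier := PUnit.{u + 1}
  deg _ := ⊥
  isInternal := isInternal_of_subsingleton _
  smul_mem _ _ := Subsingleton.elim _ _

/-- The direct sum `M ⊕ N`, with `(M ⊕ N)_γ = M_γ ⊕ N_γ`. -/
def prod (M N : GrModule 𝒜) : GrModule 𝒜 where
  carrier := M.carrier × N.carrier
  deg i := (M.deg i).prod (N.deg i)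
  isInternal := by
    let f₁ : ∀ k, ((M.deg k).prod (N.deg k)) →+ M.deg k := fun k =>
      ((AddMonoidHom.fst _ _).comp ((M.deg k).prod (N.deg k)).subtype).codRestrict (M.deg k)
        fun p => p.2.1
    let f₂ : ∀ k, ((M.deg k).prod (N.deg k)) →+ N.deg k := fun k =>
      ((AddMonoidHom.snd _ _).comp ((M.deg k).prod (N.deg k)).subtype).codRestrict (N.deg k)
        fun p => p.2.2
    let g₁ : ∀ k, M.deg k →+ ((M.deg k).prod (N.deg k)) := fun k =>
      ((AddMonoidHom.inl M.carrier N.carrier).comp (M.deg k).subtype).codRestrict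
        ((M.deg k).prod (N.deg k)) fun p => ⟨p.2, (N.deg k).zero_mem⟩
    let g₂ : ∀ k, N.deg k →+ ((M.deg k).prod (N.deg k)) := fun k =>
      ((AddMonoidHom.inr M.carrier N.carrier).comp (N.deg k).subtype).codRestrict
        ((M.deg k).prod (N.deg k)) fun p => ⟨(M.deg k).zero_mem, p.2⟩
    constructor
    · intro a b hab
      have h1 : DirectSum.map f₁ a = DirectSum.map f₁ b := by
        apply M.isInternal.1
        rw [coeAddMonoidHom_map_of_comm (AddMonoidHom.fst M.carrier N.carrier) f₁
            (fun _ _ => rfl), hab,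
          ← coeAddMonoidHom_map_of_comm (AddMonoidHom.fst M.carrier N.carrier) f₁
            (fun _ _ => rfl)]
      have h2 : DirectSum.map f₂ a = DirectSum.map f₂ b := by
        apply N.isInternal.1
        rw [coeAddMonoidHom_map_of_comm (AddMonoidHom.snd M.carrier N.carrier) f₂
            (fun _ _ => rfl), hab,
          ← coeAddMonoidHom_map_of_comm (AddMonoidHom.snd M.carrier N.carrier) f₂
            (fun _ _ => rfl)]
      ext i : 1
      have h3 := congrArg (fun t => (t i : M.carrier)) h1
      have h4 := congrArg (fun t => (t i : N.carrier)) h2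
      simp only [DirectSum.map_apply] at h3 h4
      exact Subtype.ext (Prod.ext h3 h4)
    · rintro ⟨m, n⟩
      obtain ⟨a, ha⟩ := M.isInternal.2 m
      obtain ⟨b, hb⟩ := N.isInternal.2 n
      refine ⟨DirectSum.map g₁ a + DirectSum.map g₂ b, ?_⟩
      rw [map_add, coeAddMonoidHom_map_of_comm (AddMonoidHom.inl M.carrier N.carrier) g₁
          (fun _ _ => rfl),
        coeAddMonoidHom_map_of_comm (AddMonoidHom.inr M.carrier N.carrier) g₂
          (fun _ _ => rfl), ha, hb]
      simp
  smul_mem hm ha := ⟨M.smul_mem hm.1 ha, N.smul_mem hm.2 ha⟩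

/-- The shifted module `M(δ)`, with `M(δ)_γ = M_{δ+γ}`. -/
def shift (δ : Γ) (M : GrModule 𝒜) : GrModule 𝒜 where
  carrier := M.carrier
  deg γ := M.deg (δ + γ)
  isInternal := by
    let e : (⨁ i, M.deg i) ≃+ ⨁ γ, M.deg (δ + γ) :=
      DirectSum.equivCongrLeft (β := fun i => M.deg i) (Equiv.addLeft δ).symm
    have he : ∀ (k : Γ) (p : M.deg (δ + k)), e (DirectSum.of (fun i => M.deg i) (δ + k) p) =
        DirectSum.of (fun γ => M.deg (δ + γ)) k p := fun k p =>
      DirectSum.equivCongrLeft_of (β := fun i => M.deg i) (Equiv.addLeft δ).symm k p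
    have h : (DirectSum.coeAddMonoidHom fun γ => M.deg (δ + γ)).comp e.toAddMonoidHom =
        DirectSum.coeAddMonoidHom M.deg := by
      refine DirectSum.addHom_ext fun i p => ?_
      obtain ⟨k, rfl⟩ := (Equiv.addLeft δ).surjective i
      have h1 (p : M.deg (δ + k)) : DirectSum.coeAddMonoidHom (fun γ => M.deg (δ + γ))
          (e (DirectSum.of (fun i => M.deg i) (δ + k) p)) =
          DirectSum.coeAddMonoidHom M.deg (DirectSum.of (fun i => M.deg i) (δ + k) p) := by
        rw [he, DirectSum.coeAddMonoidHom_of, DirectSum.coeAddMonoidHom_of]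
      exact h1 p
    have h' : (DirectSum.coeAddMonoidHom fun γ => M.deg (δ + γ)) ∘ e =
        DirectSum.coeAddMonoidHom M.deg := congrArg DFunLike.coe h
    have hb := M.isInternal
    unfold DirectSum.IsInternal at hb ⊢
    rw [← h'] at hb
    exact (Function.Bijective.of_comp_iff _ e.bijective).1 hb
  smul_mem hm ha := by
    rw [← add_assoc]
    exact M.smul_mem hm ha

theorem isFG_zero : (zero 𝒜).IsFG := inferInstanceAs (Module.Finite Aᵐᵒᵖ PUnit.{u + 1})

theorem IsFG.prod {M N : GrModule 𝒜} (hM : M.IsFG) (hN : N.IsFG) : (M.prod N).IsFG :=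
  have : Module.Finite Aᵐᵒᵖ M.carrier := hM
  have : Module.Finite Aᵐᵒᵖ N.carrier := hN
  inferInstanceAs (Module.Finite Aᵐᵒᵖ (M.carrier × N.carrier))

theorem IsFG.shift {M : GrModule 𝒜} (hM : M.IsFG) (δ : Γ) : (M.shift δ).IsFG := hM

theorem isGradedProjective_zero : (zero 𝒜).IsGradedProjective := by
  intro M N g j _ _ _
  refine ⟨0, fun i m _ => (M.deg i).zero_mem, ?_⟩
  ext p
  have : p = 0 := Subsingleton.elim (α := PUnit) _ _
  simp [this]

theorem IsGradedProjective.prod {P Q : GrModule 𝒜} (hP : P.IsGradedProjective)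
    (hQ : Q.IsGradedProjective) : (P.prod Q).IsGradedProjective := by
  intro M N g j hg hs hj
  obtain ⟨h₁, hh₁, e₁⟩ := hP M N g (j ∘ₗ LinearMap.inl Aᵐᵒᵖ P.carrier Q.carrier) hg hs
    fun i m hm => hj i (m, 0) ⟨hm, (Q.deg i).zero_mem⟩
  obtain ⟨h₂, hh₂, e₂⟩ := hQ M N g (j ∘ₗ LinearMap.inr Aᵐᵒᵖ P.carrier Q.carrier) hg hs
    fun i m hm => hj i (0, m) ⟨(P.deg i).zero_mem, hm⟩
  refine ⟨LinearMap.coprod h₁ h₂, fun i m hm => ?_, ?_⟩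
  · exact (M.deg i).add_mem (hh₁ i _ hm.1) (hh₂ i _ hm.2)
  · exact LinearMap.ext fun m => by
      have h1 := LinearMap.congr_fun e₁ m.1
      have h2 := LinearMap.congr_fun e₂ m.2
      change g (h₁ m.1 + h₂ m.2) = j m
      rw [map_add]
      refine (congrArg₂ (· + ·) h1 h2).trans ?_
      refine (map_add j (m.1, 0) (0, m.2)).symm.trans (congrArg j ?_)
      exact Prod.ext (add_zero m.1) (zero_add m.2)

theorem IsGradedHom.shift {M N : GrModule 𝒜} {f : M.carrier →ₗ[Aᵐᵒᵖ] N.carrier}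
    (hf : IsGradedHom f) (δ : Γ) :
    IsGradedHom (M := M.shift δ) (N := N.shift δ) f := fun i m hm => hf (δ + i) m hm

theorem IsGradedProjective.shift {P : GrModule 𝒜} (hP : P.IsGradedProjective) (δ : Γ) :
    (P.shift δ).IsGradedProjective := by
  intro M N g j hg hs hj
  obtain ⟨h, hh, e⟩ := hP (M.shift (-δ)) (N.shift (-δ)) g j (hg.shift (-δ)) hs
    fun i m hm => hj (-δ + i) m (by
      change m ∈ P.deg (δ + (-δ + i))
      rwa [add_neg_cancel_left])
  refine ⟨h, fun i m hm => ?_, e⟩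
  have : h m ∈ M.deg (-δ + (δ + i)) := hh (δ + i) m hm
  rwa [neg_add_cancel_left] at this

end GrModule

/-- Objects of `Pgr-A`: graded finitely generated projective right modules. -/
def PgrModule (𝒜 : Γ → σ) [GradedRing 𝒜] : Type (max (u + 1) x) :=
  {P : GrModule 𝒜 // P.IsFG ∧ P.IsGradedProjective}

instance PgrModule.setoid (𝒜 : Γ → σ) [GradedRing 𝒜] : Setoid (PgrModule 𝒜) where
  r P Q := P.1.IsIso Q.1
  iseqv := ⟨fun P => .refl P.1, .symm, .trans⟩

/-- `𝒱^gr(A)`: graded isomorphism classes of graded finitely generated projective right modules. -/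
def Vgr (𝒜 : Γ → σ) [GradedRing 𝒜] : Type (max (u + 1) x) := Quotient (PgrModule.setoid 𝒜)

namespace Vgr

variable {𝒜 : Γ → σ} [GradedRing 𝒜]

/-- The class `[P]` in `𝒱^gr(A)`. -/
def mk (P : PgrModule 𝒜) : Vgr 𝒜 := Quotient.mk _ P

theorem sound {P Q : PgrModule 𝒜} (h : P.1.IsIso Q.1) : mk P = mk Q := Quotient.sound h

/-- `[P] + [Q] = [P ⊕ Q]`. -/
instance : Add (Vgr 𝒜) where
  add := Quotient.map₂ (fun P Q => ⟨P.1.prod Q.1, P.2.1.prod Q.2.1, P.2.2.prod Q.2.2⟩)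
    fun _ _ ⟨e, he⟩ _ _ ⟨f, hf⟩ =>
      ⟨e.prodCongr f, fun i _ hm => ⟨he i _ hm.1, hf i _ hm.2⟩⟩

instance : Zero (Vgr 𝒜) where
  zero := mk ⟨GrModule.zero 𝒜, GrModule.isFG_zero, GrModule.isGradedProjective_zero⟩

instance : AddCommMonoid (Vgr 𝒜) where
  add_assoc := by
    rintro ⟨P⟩ ⟨Q⟩ ⟨R⟩
    exact sound ⟨LinearEquiv.prodAssoc Aᵐᵒᵖ P.1.carrier Q.1.carrier R.1.carrier,
      fun i m hm => ⟨hm.1.1, hm.1.2, hm.2⟩⟩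
  zero_add := by
    rintro ⟨P⟩
    exact sound ⟨LinearEquiv.uniqueProd (R := Aᵐᵒᵖ) (M := P.1.carrier) (M₂ := PUnit.{u + 1}),
      fun i m hm => hm.2⟩
  add_zero := by
    rintro ⟨P⟩
    exact sound ⟨LinearEquiv.prodUnique (R := Aᵐᵒᵖ) (M := P.1.carrier) (M₂ := PUnit.{u + 1}),
      fun i m hm => hm.1⟩
  add_comm := by
    rintro ⟨P⟩ ⟨Q⟩
    exact sound ⟨LinearEquiv.prodComm Aᵐᵒᵖ P.1.carrier Q.1.carrier, fun i m hm => ⟨hm.2, hm.1⟩⟩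
  nsmul := nsmulRec

theorem mk_add_mk (P Q : PgrModule 𝒜) :
    mk P + mk Q = mk ⟨P.1.prod Q.1, P.2.1.prod Q.2.1, P.2.2.prod Q.2.2⟩ := rfl

/-- The action of `δ : Γ` on `𝒱^gr(A)`, `[P] ↦ [P(δ)]`. -/
def shift (δ : Γ) : Vgr 𝒜 →+ Vgr 𝒜 where
  toFun := Quotient.map (fun P => ⟨P.1.shift δ, P.2.1.shift δ, P.2.2.shift δ⟩)
    fun _ _ ⟨e, he⟩ => ⟨e, GrModule.IsGradedHom.shift he δ⟩
  map_zero' := sound ⟨LinearEquiv.refl _ _, fun _ _ h => h⟩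
  map_add' := by
    rintro ⟨P⟩ ⟨Q⟩
    exact sound ⟨LinearEquiv.refl _ _, fun _ _ h => h⟩

theorem shift_mk (δ : Γ) (P : PgrModule 𝒜) :
    shift δ (mk P) = mk ⟨P.1.shift δ, P.2.1.shift δ, P.2.2.shift δ⟩ := rfl

theorem shift_zero : shift (0 : Γ) = AddMonoidHom.id (Vgr 𝒜) := by
  ext ⟨P⟩
  refine sound ⟨LinearEquiv.refl _ _, fun i m hm => ?_⟩
  have hm' : m ∈ P.1.deg (0 + i) := hm
  rwa [zero_add] at hm'

theorem shift_add (δ ε : Γ) :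
    shift (δ + ε) = (shift δ).comp (shift ε : Vgr 𝒜 →+ Vgr 𝒜) := by
  ext ⟨P⟩
  refine sound ⟨LinearEquiv.refl _ _, fun i m hm => ?_⟩
  change m ∈ P.1.deg (ε + (δ + i))
  have hm' : m ∈ P.1.deg (δ + ε + i) := hm
  rwa [add_comm δ ε, add_assoc] at hm'

end Vgr

/-- The graded Grothendieck group `K₀^gr(A)`: the group completion of `𝒱^gr(A)`. -/
abbrev K0gr (𝒜 : Γ → σ) [GradedRing 𝒜] : Type (max (u + 1) x) :=
  Algebra.GrothendieckAddGroup (Vgr 𝒜)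

namespace K0gr

variable {𝒜 : Γ → σ} [GradedRing 𝒜]

/-- The natural map `𝒱^gr(A) → K₀^gr(A)`. -/
noncomputable def of : Vgr 𝒜 →+ K0gr 𝒜 := Algebra.GrothendieckAddGroup.of

/-- The positive cone `K₀^gr(A)₊`: the image of `𝒱^gr(A)` in `K₀^gr(A)`. -/
def posCone (𝒜 : Γ → σ) [GradedRing 𝒜] : Set (K0gr 𝒜) := Set.range (of (𝒜 := 𝒜))

theorem hom_ext {H : Type*} [AddCommGroup H] {f g : K0gr 𝒜 →+ H}
    (h : ∀ p, f (of p) = g (of p)) : f = g :=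
  Algebra.GrothendieckAddGroup.lift.symm.injective (AddMonoidHom.ext h)

/-- The action of `δ : Γ` on `K₀^gr(A)` induced by the shift `[P] ↦ [P(δ)]`. -/
noncomputable def shift (δ : Γ) : K0gr 𝒜 →+ K0gr 𝒜 :=
  Algebra.GrothendieckAddGroup.lift (of.comp (Vgr.shift δ))

theorem shift_of (δ : Γ) (p : Vgr 𝒜) : shift δ (of p) = of (Vgr.shift δ p) :=
  DFunLike.congr_fun
    (Algebra.GrothendieckAddGroup.lift.symm_apply_apply (of.comp (Vgr.shift δ))) p

/-- The action of the group `Γ` on `K₀^gr(A)`. -/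
noncomputable def shiftHom (𝒜 : Γ → σ) [GradedRing 𝒜] :
    Multiplicative Γ →* Module.End ℤ (K0gr 𝒜) where
  toFun δ := (shift δ.toAdd).toIntLinearMap
  map_one' := by
    have : shift (0 : Γ) = AddMonoidHom.id (K0gr 𝒜) := hom_ext fun p => by
      rw [shift_of, Vgr.shift_zero]; rfl
    ext α
    exact DFunLike.congr_fun this α
  map_mul' δ ε := by
    have : shift (δ.toAdd + ε.toAdd) = (shift δ.toAdd).comp (shift ε.toAdd : K0gr 𝒜 →+ _) :=
      hom_ext fun p => by
        rw [shift_of, Vgr.shift_add, AddMonoidHom.comp_apply]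
        exact ((congrArg (shift δ.toAdd) (shift_of _ p)).trans (shift_of _ _)).symm
    ext α
    exact DFunLike.congr_fun this α

/-- The `ℤ[Γ]`-module structure of `K₀^gr(A)`, in which `γ ∈ Γ` acts by `[P] ↦ [P(γ)]`. For `Γ = ℤ`
this is a `ℤ[x, x⁻¹]`-module structure. -/
noncomputable instance : Module (AddMonoidAlgebra ℤ Γ) (K0gr 𝒜) :=
  Module.compHom (K0gr 𝒜)
    (AddMonoidAlgebra.lift ℤ (Module.End ℤ (K0gr 𝒜)) Γ (shiftHom 𝒜)).toRingHom

theorem single_smul_of_mk (γ : Γ) (P : PgrModule 𝒜) :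
    (AddMonoidAlgebra.single γ 1 : AddMonoidAlgebra ℤ Γ) • of (Vgr.mk P) =
      of (Vgr.mk ⟨P.1.shift γ, P.2.1.shift γ, P.2.2.shift γ⟩) := by
  change (AddMonoidAlgebra.lift ℤ (Module.End ℤ (K0gr 𝒜)) Γ (shiftHom 𝒜)
    (AddMonoidAlgebra.single γ 1)) (of (Vgr.mk P)) = _
  rw [AddMonoidAlgebra.lift_single, one_smul]
  exact shift_of γ (Vgr.mk P)

end K0gr

end GradedModules

/-! ### Directed graphs and Leavitt path algebras -/

/-- A directed graph `(E⁰, E¹, r, s)` with vertex set `V = E⁰`, edge set `E = E¹`, and range and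
source maps `r`, `s`. -/
structure DirectedGraph (V : Type u) (E : Type v) where
  r : E → V
  s : E → V

namespace DirectedGraph

variable {V : Type u} {E : Type v} [Fintype V] [Fintype E] [DecidableEq V]

/-- `(n_{v,w})`, where `n_{v,w}` is the number of edges with source `v` and range `w`. -/
def adjMatrix (G : DirectedGraph V E) : Matrix V V ℤ :=
  Matrix.of fun v w => ((Finset.univ.filter fun e => G.s e = v ∧ G.r e = w).card : ℤ)

/-- A graph has no sinks if every vertex emits an edge. -/
def NoSinks (G : DirectedGraph V E) : Prop := ∀ v, ∃ e, G.s e = v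

end DirectedGraph

/-- The generators `v`, `α`, `α*` of the Leavitt path algebra. -/
inductive LPAGen (V : Type u) (E : Type v) : Type (max u v)
  | vertex (v : V)
  | edge (e : E)
  | ghost (e : E)

namespace LPAGen

variable {V : Type u} {E : Type v}

/-- `deg v = 0`, `deg α = 1`, `deg α* = -1`. -/
def degree : LPAGen V E → ℤ
  | vertex _ => 0
  | edge _ => 1
  | ghost _ => -1

end LPAGen

section LPA

variable {V : Type u} {E : Type v} [Fintype V] [Fintype E] [DecidableEq V]
variable (K : Type w) [Field K] (G : DirectedGraph V E)

open LPAGen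

/-- The defining relations of the Leavitt path algebra of a finite graph. The last relation identifies
the unit of the (unital) free algebra with `∑ v`, which is the identity of the algebra presented
by the other relations. -/
inductive LPARel : FreeAlgebra K (LPAGen V E) → FreeAlgebra K (LPAGen V E) → Prop
  | vertex_mul_self (v : V) : LPARel
      (FreeAlgebra.ι K (vertex v) * FreeAlgebra.ι K (vertex v)) (FreeAlgebra.ι K (vertex v))
  | vertex_mul_of_ne (v w : V) (h : v ≠ w) : LPARel
      (FreeAlgebra.ι K (vertex v) * FreeAlgebra.ι K (vertex w)) 0
  | source_mul_edge (e : E) : LPARel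
      (FreeAlgebra.ι K (vertex (G.s e)) * FreeAlgebra.ι K (edge e)) (FreeAlgebra.ι K (edge e))
  | edge_mul_range (e : E) : LPARel
      (FreeAlgebra.ι K (edge e) * FreeAlgebra.ι K (vertex (G.r e))) (FreeAlgebra.ι K (edge e))
  | range_mul_ghost (e : E) : LPARel
      (FreeAlgebra.ι K (vertex (G.r e)) * FreeAlgebra.ι K (ghost e)) (FreeAlgebra.ι K (ghost e))
  | ghost_mul_source (e : E) : LPARel
      (FreeAlgebra.ι K (ghost e) * FreeAlgebra.ι K (vertex (G.s e))) (FreeAlgebra.ι K (ghost e))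
  | ghost_mul_edge (e : E) : LPARel
      (FreeAlgebra.ι K (ghost e) * FreeAlgebra.ι K (edge e)) (FreeAlgebra.ι K (vertex (G.r e)))
  | ghost_mul_edge_of_ne (e f : E) (h : e ≠ f) : LPARel
      (FreeAlgebra.ι K (ghost e) * FreeAlgebra.ι K (edge f)) 0
  | sum_edge_mul_ghost (v : V) (h : ∃ e, G.s e = v) : LPARel
      (∑ e ∈ Finset.univ.filter (fun e => G.s e = v),
        FreeAlgebra.ι K (edge e) * FreeAlgebra.ι K (ghost e)) (FreeAlgebra.ι K (vertex v))
  | sum_vertex : LPARel (∑ v : V, FreeAlgebra.ι K (vertex v)) 1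

/-- The Leavitt path algebra `L_K(E)` of a finite graph. -/
abbrev LPA : Type (max u v w) := RingQuot (LPARel K G)

namespace LPA

/-- The image of a generator in `L_K(E)`. -/
noncomputable def gen (g : LPAGen V E) : LPA K G :=
  RingQuot.mkAlgHom K (LPARel K G) (FreeAlgebra.ι K g)

/-- The degree `k` component of `L_K(E)`: the span of all words in the generators of total
degree `k`. -/
noncomputable def grading (k : ℤ) : Submodule K (LPA K G) :=
  Submodule.span K
    {a | ∃ l : List (LPAGen V E), (l.map degree).sum = k ∧ (l.map (gen K G)).prod = a}

instance : SetLike.GradedMonoid (grading K G) where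
  one_mem := Submodule.subset_span ⟨[], by simp, by simp⟩
  mul_mem i j a b ha hb := by
    have h := Submodule.mul_mem_mul ha hb
    rw [grading, grading, Submodule.span_mul_span] at h
    refine Submodule.span_mono ?_ h
    rintro _ ⟨_, ⟨l, hl, rfl⟩, _, ⟨l', hl', rfl⟩, rfl⟩
    exact ⟨l ++ l', by simp [hl, hl'], by simp⟩

theorem gen_mem (g : LPAGen V E) : gen K G g ∈ grading K G g.degree :=
  Submodule.subset_span ⟨[g], by simp, by simp⟩

/-- A generator as a homogeneous element of `⨁ L_k`. -/
noncomputable def genDecomp (g : LPAGen V E) : ⨁ k, grading K G k :=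
  DirectSum.of (fun k => grading K G k) g.degree ⟨gen K G g, gen_mem K G g⟩

theorem gen_rel {a b : FreeAlgebra K (LPAGen V E)} (h : LPARel K G a b) :
    FreeAlgebra.lift K (gen K G) a = FreeAlgebra.lift K (gen K G) b := by
  have : FreeAlgebra.lift K (gen K G) = RingQuot.mkAlgHom K (LPARel K G) := by
    ext g; simp [gen]
  rw [this]
  exact RingQuot.mkAlgHom_rel K h

theorem of_congr {i j : ℤ} (hij : i = j) {a b : LPA K G} (hab : a = b)
    (ha : a ∈ grading K G i) (hb : b ∈ grading K G j) :
    DirectSum.of (fun k => grading K G k) i ⟨a, ha⟩ =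
      DirectSum.of (fun k => grading K G k) j ⟨b, hb⟩ := by
  subst hij hab; rfl

theorem genDecomp_mul (g h : LPAGen V E) :
    genDecomp K G g * genDecomp K G h =
      DirectSum.of (fun k => grading K G k) (g.degree + h.degree)
        ⟨gen K G g * gen K G h, SetLike.mul_mem_graded (gen_mem K G g) (gen_mem K G h)⟩ :=
  DirectSum.of_mul_of _ _

theorem genDecomp_mul_eq (g h k : LPAGen V E) (hd : g.degree + h.degree = k.degree)
    (hr : gen K G g * gen K G h = gen K G k) :
    genDecomp K G g * genDecomp K G h = genDecomp K G k := by
  rw [genDecomp_mul]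
  exact of_congr K G hd hr _ _

theorem genDecomp_mul_eq_zero (g h : LPAGen V E) (hr : gen K G g * gen K G h = 0) :
    genDecomp K G g * genDecomp K G h = 0 := by
  rw [genDecomp_mul]
  have : (⟨gen K G g * gen K G h, SetLike.mul_mem_graded (gen_mem K G g) (gen_mem K G h)⟩ :
    grading K G (g.degree + h.degree)) = 0 := Subtype.ext hr
  rw [this, map_zero]

theorem edge_mul_ghost_mem (e : E) :
    gen K G (edge e) * gen K G (ghost e) ∈ grading K G 0 := by
  have h := SetLike.mul_mem_graded (gen_mem K G (edge e)) (gen_mem K G (ghost e))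
  have h0 : (edge e : LPAGen V E).degree + (ghost e : LPAGen V E).degree = 0 := by simp [degree]
  rwa [h0] at h

theorem genDecomp_edge_mul_ghost (e : E) :
    genDecomp K G (edge e) * genDecomp K G (ghost e) =
      DirectSum.of (fun k => grading K G k) 0
        ⟨gen K G (edge e) * gen K G (ghost e), edge_mul_ghost_mem K G e⟩ := by
  rw [genDecomp_mul]
  exact of_congr K G (by simp [degree]) rfl _ _

theorem genDecomp_rel {a b : FreeAlgebra K (LPAGen V E)} (h : LPARel K G a b) :
    FreeAlgebra.lift K (genDecomp K G) a = FreeAlgebra.lift K (genDecomp K G) b := by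
  have hr := gen_rel K G h
  cases h with
  | sum_edge_mul_ghost v h =>
    simp only [map_sum, map_mul, FreeAlgebra.lift_ι_apply] at hr ⊢
    simp only [genDecomp_edge_mul_ghost]
    rw [← map_sum]
    refine congrArg (DirectSum.of (fun k => grading K G k) 0) (Subtype.ext ?_)
    simpa using hr
  | sum_vertex =>
    simp only [map_sum, map_one, FreeAlgebra.lift_ι_apply] at hr ⊢
    have h0 : ∀ v : V, genDecomp K G (vertex v) =
        DirectSum.of (fun k => grading K G k) 0 ⟨gen K G (vertex v), gen_mem K G (vertex v)⟩ :=
      fun v => rfl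
    simp only [h0]
    rw [← map_sum, DirectSum.one_def]
    refine congrArg (DirectSum.of (fun k => grading K G k) 0) (Subtype.ext ?_)
    simpa using hr
  | vertex_mul_of_ne v w h =>
    simp only [map_mul, map_zero, FreeAlgebra.lift_ι_apply] at hr ⊢
    exact genDecomp_mul_eq_zero K G _ _ hr
  | ghost_mul_edge_of_ne e f h =>
    simp only [map_mul, map_zero, FreeAlgebra.lift_ι_apply] at hr ⊢
    exact genDecomp_mul_eq_zero K G _ _ hr
  | _ =>
    simp only [map_mul, FreeAlgebra.lift_ι_apply] at hr ⊢
    exact genDecomp_mul_eq K G _ _ _ (by simp [degree]) hr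

/-- The decomposition map `L_K(E) → ⨁ L_k`. -/
noncomputable def decompHom : LPA K G →ₐ[K] ⨁ k, grading K G k :=
  RingQuot.liftAlgHom K ⟨FreeAlgebra.lift K (genDecomp K G), fun _ _ h => genDecomp_rel K G h⟩

theorem decompHom_gen (g : LPAGen V E) : decompHom K G (gen K G g) = genDecomp K G g := by
  simp [decompHom, gen]

theorem decompHom_prod (l : List (LPAGen V E)) :
    decompHom K G (l.map (gen K G)).prod =
      DirectSum.of (fun k => grading K G k) (l.map degree).sum
        ⟨(l.map (gen K G)).prod, Submodule.subset_span ⟨l, rfl, rfl⟩⟩ := by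
  induction l with
  | nil => simp only [List.map_nil, List.prod_nil, map_one]; rfl
  | cons g l ih =>
    simp only [List.map_cons, List.prod_cons, map_mul]
    rw [ih, decompHom_gen, genDecomp, DirectSum.of_mul_of]
    exact of_congr K G (by simp) rfl _ _

/-- The standard `ℤ`-grading of the Leavitt path algebra. -/
noncomputable instance : GradedAlgebra (grading K G) :=
  GradedAlgebra.ofAlgHom (grading K G) (decompHom K G)
    (by
      refine RingQuot.ringQuot_ext' _ _ _ (FreeAlgebra.hom_ext (funext fun g => ?_))
      change DirectSum.coeAlgHom (grading K G) (decompHom K G (gen K G g)) = gen K G g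
      rw [decompHom_gen, genDecomp, DirectSum.coeAlgHom_of])
    (by
      rintro i ⟨a, ha⟩
      change decompHom K G a = _
      induction ha using Submodule.span_induction with
      | mem a h =>
        obtain ⟨l, rfl, rfl⟩ := h
        exact decompHom_prod K G l
      | zero =>
        rw [map_zero]
        exact (map_zero (DirectSum.of (fun k => grading K G k) i)).symm
      | add a b ha hb iha ihb =>
        rw [map_add, iha, ihb, ← map_add]
        rfl
      | smul c a ha iha =>
        rw [map_smul, iha]
        exact (map_smul (DirectSum.lof K ℤ (fun k => grading K G k) i) c ⟨a, ha⟩).symm)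

end LPA

end LPA

/-! ### Krieger's dimension group -/

section Krieger

variable {n : Type u} [Fintype n] [DecidableEq n]

/-- The transition maps `A ^ (j - i) : ℤⁿ → ℤⁿ` of the stationary system given by `A`. -/
def stationaryMap (A : Matrix n n ℤ) (i j : ℕ) (_ : i ≤ j) : (n → ℤ) →+ (n → ℤ) :=
  (A ^ (j - i)).mulVecLin.toAddMonoidHom

/-- `Δ_A`, the direct limit of `ℤⁿ → ℤⁿ → ℤⁿ → ⋯`, all maps being multiplication by `A` from
the left. -/
abbrev KriegerGroup (A : Matrix n n ℤ) : Type u :=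
  AddCommGroup.DirectLimit (fun _ : ℕ => n → ℤ) (stationaryMap A)

namespace KriegerGroup

variable (A : Matrix n n ℤ)

/-- The class `[a, k] ∈ Δ_A` of a vector `a` in the `k`-th copy of `ℤⁿ`. -/
noncomputable def mk (k : ℕ) : (n → ℤ) →+ KriegerGroup A :=
  AddCommGroup.DirectLimit.of (fun _ : ℕ => n → ℤ) (stationaryMap A) k

/-- The positive cone `Δ_A⁺`: the classes `[a, k]` with `a` nonnegative. -/
def posCone : Set (KriegerGroup A) := {z | ∃ (k : ℕ) (a : n → ℤ), 0 ≤ a ∧ z = mk A k a}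

/-- The endomorphism `[a, k] ↦ [A a, k]` of `Δ_A` induced by `A`. -/
noncomputable def deltaHom : KriegerGroup A →+ KriegerGroup A :=
  AddCommGroup.DirectLimit.map (fun _ => A.mulVecLin.toAddMonoidHom) fun i j h => by
    refine AddMonoidHom.ext fun a => ?_
    change A *ᵥ ((A ^ (j - i)) *ᵥ a) = (A ^ (j - i)) *ᵥ (A *ᵥ a)
    rw [Matrix.mulVec_mulVec, Matrix.mulVec_mulVec, (Commute.self_pow A _).eq]

theorem deltaHom_mk (k : ℕ) (a : n → ℤ) : deltaHom A (mk A k a) = mk A k (A *ᵥ a) :=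
  AddCommGroup.DirectLimit.map_apply_of _ _ _

theorem mk_succ_mulVec (k : ℕ) (a : n → ℤ) : mk A (k + 1) (A *ᵥ a) = mk A k a := by
  have h := AddCommGroup.DirectLimit.of_f (G := fun _ : ℕ => n → ℤ) (f := stationaryMap A)
    (Nat.le_succ k) a
  have h' : stationaryMap A k (k + 1) (Nat.le_succ k) a = A *ᵥ a := by
    change (A ^ (k + 1 - k)) *ᵥ a = _
    simp
  rw [← h']
  exact h

/-- The inverse `[a, k] ↦ [a, k + 1]` of `deltaHom`. -/
noncomputable def deltaInv : KriegerGroup A →+ KriegerGroup A :=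
  AddCommGroup.DirectLimit.lift _ _ _ (fun k => mk A (k + 1)) fun i j h a => by
    have h1 := AddCommGroup.DirectLimit.of_f (G := fun _ : ℕ => n → ℤ) (f := stationaryMap A)
      (Nat.succ_le_succ h) a
    have h2 : stationaryMap A (i + 1) (j + 1) (Nat.succ_le_succ h) a = stationaryMap A i j h a := by
      change (A ^ (j + 1 - (i + 1))) *ᵥ a = (A ^ (j - i)) *ᵥ a
      rw [Nat.add_sub_add_right]
    rw [← h2]
    exact h1

theorem deltaInv_mk (k : ℕ) (a : n → ℤ) : deltaInv A (mk A k a) = mk A (k + 1) a :=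
  AddCommGroup.DirectLimit.lift_of _ _ _ _ _

/-- The automorphism `δ_A` of `Δ_A` induced by `A`: `δ_A [a, k] = [A a, k]`. -/
noncomputable def delta : KriegerGroup A ≃+ KriegerGroup A :=
  AddMonoidHom.toAddEquiv (deltaHom A) (deltaInv A)
    (AddCommGroup.DirectLimit.hom_ext _ fun k => AddMonoidHom.ext fun a => by
      change deltaInv A (deltaHom A (mk A k a)) = mk A k a
      rw [deltaHom_mk, deltaInv_mk, mk_succ_mulVec])
    (AddCommGroup.DirectLimit.hom_ext _ fun k => AddMonoidHom.ext fun a => by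
      change deltaHom A (deltaInv A (mk A k a)) = mk A k a
      rw [deltaInv_mk, deltaHom_mk, mk_succ_mulVec])

end KriegerGroup

end Krieger

/-!
Write `L = L_K(E)`. If homogeneous elements of degree `k` generate a graded finitely generated
projective module `P`, then they are part of a frame of `P`, that is, they come with coordinates
expressing the identity of `P`, and the Gram matrix of the frame (the coordinates of its vectors) is
an idempotent matrix over `L₀` that determines `P`. Changing the frame replaces this matrix by a
Murray-von Neumann equivalent one.

Since the graph has no sinks, the edges satisfy `∑ e, e e* = 1`, so a frame of degree `k` with Gram
matrix `g` can be refined to one of degree `k + 1`, with Gram matrix `e* g e'`. Every element of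
`L₀` is carried into the subalgebra `K ^ V` spanned by the vertices by finitely many such steps. So
in large degree `P` has a Gram matrix over `K ^ V`, which is classified by its ranks at the
vertices. One more refinement multiplies the vector of ranks by `Aᵗ`, and the ranks in two frames
of the same degree agree after finitely many refinements, because the transition matrices between
the frames are carried into `K ^ V` too. The classes of graded modules are therefore the positive
elements of Krieger's dimension group, and the shift, which lowers the degree of a frame by one,
becomes multiplication by `Aᵗ`.
-/

/-! ### Idempotent matrices up to Murray–von Neumann equivalence -/

section MvNEquiv

variable {ι κ ι' κ' R : Type*} [Fintype ι] [Fintype κ] [Fintype ι'] [Fintype κ']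

/-- Murray–von Neumann equivalence of square matrices of possibly different sizes: `e = W U` and
`f = U W`. For idempotents it says that the projective modules they define are isomorphic. -/
def MvNEquiv [Semiring R] (e : Matrix ι ι R) (f : Matrix κ κ R) : Prop :=
  ∃ (W : Matrix ι κ R) (U : Matrix κ ι R), W * U = e ∧ U * W = f

namespace MvNEquiv

theorem symm [Semiring R] {e : Matrix ι ι R} {f : Matrix κ κ R} :
    MvNEquiv e f → MvNEquiv f e := fun ⟨W, U, hWU, hUW⟩ => ⟨U, W, hUW, hWU⟩

theorem trans_of_isIdempotentElem [Semiring R] {e : Matrix ι ι R} {f : Matrix κ κ R}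
    {g : Matrix ι' ι' R} (he : IsIdempotentElem e) (hg : IsIdempotentElem g) :
    MvNEquiv e f → MvNEquiv f g → MvNEquiv e g := by
  rintro ⟨W, U, hWU, hUW⟩ ⟨W', U', hWU', hUW'⟩
  refine ⟨W * W', U' * U, ?_, ?_⟩
  · calc W * W' * (U' * U) = W * (W' * U') * U := by simp only [Matrix.mul_assoc]
      _ = W * U * (W * U) := by rw [hWU', ← hUW]; simp only [Matrix.mul_assoc]
      _ = e := by rw [hWU, he.eq]
  · calc U' * U * (W * W') = U' * (U * W) * W' := by simp only [Matrix.mul_assoc]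
      _ = U' * W' * (U' * W') := by rw [hUW, ← hWU']; simp only [Matrix.mul_assoc]
      _ = g := by rw [hUW', hg.eq]

theorem map [Semiring R] {S : Type*} [Semiring S] {e : Matrix ι ι R} {f : Matrix κ κ R}
    (h : MvNEquiv e f) (φ : R →+* S) : MvNEquiv (e.map φ) (f.map φ) := by
  obtain ⟨W, U, rfl, rfl⟩ := h
  exact ⟨W.map φ, U.map φ, Matrix.map_mul.symm, Matrix.map_mul.symm⟩

theorem pi {V : Type*} {S : V → Type*} [∀ v, Semiring (S v)] {e : Matrix ι ι (∀ v, S v)}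
    {f : Matrix κ κ (∀ v, S v)}
    (h : ∀ v, MvNEquiv (e.map (Pi.evalRingHom S v)) (f.map (Pi.evalRingHom S v))) :
    MvNEquiv e f := by
  choose W U hWU hUW using h
  refine ⟨.of fun i j v => W v i j, .of fun j i v => U v j i, ?_, ?_⟩ <;> ext i j v
  · simpa [Matrix.mul_apply] using congrFun₂ (hWU v) i j
  · simpa [Matrix.mul_apply] using congrFun₂ (hUW v) i j

theorem fromBlocks [Semiring R] {e : Matrix ι ι R} {f : Matrix κ κ R} {e' : Matrix ι' ι' R}
    {f' : Matrix κ' κ' R} (h : MvNEquiv e f) (h' : MvNEquiv e' f') :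
    MvNEquiv (Matrix.fromBlocks e 0 0 e') (Matrix.fromBlocks f 0 0 f') := by
  obtain ⟨W, U, rfl, rfl⟩ := h
  obtain ⟨W', U', rfl, rfl⟩ := h'
  exact ⟨.fromBlocks W 0 0 W', .fromBlocks U 0 0 U', by simp [Matrix.fromBlocks_multiply],
    by simp [Matrix.fromBlocks_multiply]⟩

theorem blockDiagonal' [Semiring R] {o : Type*} [Fintype o] [DecidableEq o] {m n : o → Type*}
    [∀ k, Fintype (m k)] [∀ k, Fintype (n k)] {e : ∀ k, Matrix (m k) (m k) R}
    {f : ∀ k, Matrix (n k) (n k) R} (h : ∀ k, MvNEquiv (e k) (f k)) :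
    MvNEquiv (Matrix.blockDiagonal' e) (Matrix.blockDiagonal' f) := by
  choose W U hWU hUW using h
  exact ⟨.blockDiagonal' W, .blockDiagonal' U,
    by simp only [← Matrix.blockDiagonal'_mul, hWU],
    by simp only [← Matrix.blockDiagonal'_mul, hUW]⟩

variable {K : Type*} [Field K]

theorem rank_le {e : Matrix ι ι K} {f : Matrix κ κ K} (h : MvNEquiv e f)
    (he : IsIdempotentElem e) : e.rank ≤ f.rank := by
  obtain ⟨W, U, rfl, rfl⟩ := h
  calc (W * U).rank = (W * (U * W) * U).rank := by
        rw [← he.eq]; simp only [Matrix.mul_assoc]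
    _ ≤ (U * W).rank := (Matrix.rank_mul_le_left _ _).trans (Matrix.rank_mul_le_right _ _)

theorem rank_eq {e : Matrix ι ι K} {f : Matrix κ κ K} (h : MvNEquiv e f)
    (he : IsIdempotentElem e) (hf : IsIdempotentElem f) : e.rank = f.rank :=
  (h.rank_le he).antisymm (h.symm.rank_le hf)

theorem rank_eq_card [DecidableEq κ] {e : Matrix ι ι K} (h : MvNEquiv e (1 : Matrix κ κ K))
    (he : IsIdempotentElem e) : e.rank = Fintype.card κ :=
  (h.rank_eq he .one).trans Matrix.rank_one

theorem one_rank {e : Matrix ι ι K} (he : IsIdempotentElem e) :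
    MvNEquiv e (1 : Matrix (Fin e.rank) (Fin e.rank) K) := by
  classical
  let f := Matrix.toLin' e
  let b : Module.Basis (Fin e.rank) K (LinearMap.range f) := Module.finBasis K _
  refine ⟨LinearMap.toMatrix b (Pi.basisFun K ι) (LinearMap.range f).subtype,
    LinearMap.toMatrix (Pi.basisFun K ι) b f.rangeRestrict, ?_, ?_⟩
  · rw [← LinearMap.toMatrix_comp, LinearMap.subtype_comp_codRestrict,
      LinearMap.toMatrix_eq_toMatrix', LinearMap.toMatrix'_toLin']
  · have hsplit : f.rangeRestrict ∘ₗ (LinearMap.range f).subtype = LinearMap.id := by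
      ext ⟨_, z, rfl⟩ : 2
      change f (f z) = f z
      rw [← LinearMap.comp_apply, ← Matrix.toLin'_mul, he.eq]
    rw [← LinearMap.toMatrix_comp, hsplit, LinearMap.toMatrix_id]

theorem of_rank_eq {e : Matrix ι ι K} {f : Matrix κ κ K} (he : IsIdempotentElem e)
    (hf : IsIdempotentElem f) (h : e.rank = f.rank) : MvNEquiv e f :=
  (one_rank he).trans_of_isIdempotentElem he hf (h ▸ one_rank hf).symm

end MvNEquiv

variable {K : Type*} [Field K]

theorem rank_fromBlocks_of_isIdempotentElem {e : Matrix ι ι K} {f : Matrix κ κ K}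
    (he : IsIdempotentElem e) (hf : IsIdempotentElem f) :
    (Matrix.fromBlocks e 0 0 f).rank = e.rank + f.rank := by
  have h := (MvNEquiv.one_rank he).fromBlocks (MvNEquiv.one_rank hf)
  rw [Matrix.fromBlocks_one] at h
  have hidem : IsIdempotentElem (Matrix.fromBlocks e 0 0 f) := by
    simp [IsIdempotentElem, Matrix.fromBlocks_multiply, he.eq, hf.eq]
  simpa using h.rank_eq_card hidem

theorem rank_blockDiagonal_of_isIdempotentElem {o : Type*} [Fintype o] [DecidableEq o]
    {e : o → Matrix ι ι K} (he : ∀ k, IsIdempotentElem (e k)) :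
    (Matrix.blockDiagonal e).rank = ∑ k, (e k).rank := by
  have h := MvNEquiv.blockDiagonal' fun k => MvNEquiv.one_rank (he k)
  have hone : (Matrix.blockDiagonal' fun k => (1 : Matrix (Fin (e k).rank) (Fin (e k).rank) K))
      = 1 := Matrix.blockDiagonal'_one
  have hidem : IsIdempotentElem (Matrix.blockDiagonal' e) :=
    (Matrix.blockDiagonal'_mul e e).symm.trans (congrArg _ (funext fun k => (he k).eq))
  rw [hone] at h
  rw [← Matrix.blockDiagonal'_submatrix_eq_blockDiagonal]
  calc _ = (Matrix.blockDiagonal' e).rank := Matrix.rank_submatrix _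
          ((Equiv.prodComm ι o).trans (Equiv.sigmaEquivProd o ι).symm)
          ((Equiv.prodComm ι o).trans (Equiv.sigmaEquivProd o ι).symm)
    _ = ∑ k, (e k).rank := by rw [h.rank_eq_card hidem]; simp

end MvNEquiv

/-! ### Graded free modules and graded direct summands -/

section Internal

variable {Γ : Type*} [DecidableEq Γ]

theorem exists_directSum_map {M N : Type*} [AddCommGroup M] [AddCommGroup N]
    {P : Γ → AddSubgroup M} {Q : Γ → AddSubgroup N} (F : M →+ N) (h : ∀ i, ∀ m ∈ P i, F m ∈ Q i) :
    ∃ f : (⨁ i, P i) →+ ⨁ i, Q i,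
      (∀ z, DirectSum.coeAddMonoidHom Q (f z) = F (DirectSum.coeAddMonoidHom P z)) ∧
        ∀ z i, (f z i : N) = F (z i) := by
  let f : ∀ i, P i →+ Q i := fun i =>
    (F.comp (P i).subtype).codRestrict (Q i) fun m => h i m m.2
  exact ⟨DirectSum.map f, coeAddMonoidHom_map_of_comm F f fun _ _ => rfl, fun z i => by
    rw [DirectSum.map_apply]; rfl⟩

theorem isInternal_of_retract {M N : Type*} [AddCommGroup M] [AddCommGroup N]
    {P : Γ → AddSubgroup M} {Q : Γ → AddSubgroup N} (hP : DirectSum.IsInternal P)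
    (s : N →+ M) (p : M →+ N) (hs : ∀ i, ∀ n ∈ Q i, s n ∈ P i) (hp : ∀ i, ∀ m ∈ P i, p m ∈ Q i)
    (hps : ∀ n, p (s n) = n) : DirectSum.IsInternal Q := by
  obtain ⟨s', hs', hs'_apply⟩ := exists_directSum_map s hs
  obtain ⟨p', hp', -⟩ := exists_directSum_map p hp
  refine ⟨fun a b hab => ?_, fun n => ?_⟩
  · have h : s' a = s' b := hP.1 (by rw [hs', hs', hab])
    ext i
    rw [← hps (a i), ← hps (b i), ← hs'_apply, ← hs'_apply, h]
  · obtain ⟨z, hz⟩ := hP.2 (s n)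
    exact ⟨p' z, by rw [hp', hz, hps]⟩

theorem isInternal_pi {ι : Type*} [Finite ι] {M : ι → Type*} [∀ j, AddCommGroup (M j)]
    {P : ∀ j, Γ → AddSubgroup (M j)} (hP : ∀ j, DirectSum.IsInternal (P j)) :
    DirectSum.IsInternal fun i => AddSubgroup.pi Set.univ fun j => P j i := by
  classical
  have := Fintype.ofFinite ι
  choose ev hev hev_apply using fun j => exists_directSum_map
    (P := fun i => AddSubgroup.pi Set.univ fun j => P j i) (Q := P j) (Pi.evalAddMonoidHom M j)
    fun _ _ hf => hf j trivial
  choose single hsingle _ using fun j => exists_directSum_map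
    (P := P j) (Q := fun i => AddSubgroup.pi Set.univ fun j => P j i) (AddMonoidHom.single M j)
    fun _ _ hm => (AddSubgroup.single_mem_pi _ _).2 fun _ => hm
  refine ⟨fun a b hab => ?_, fun f => ?_⟩
  · have h (j) : ev j a = ev j b := (hP j).1 (by rw [hev, hev, hab])
    ext i j
    exact (hev_apply j a i).symm.trans ((congrArg (fun z => (z i : M j)) (h j)).trans
      (hev_apply j b i))
  · choose z hz using fun j => (hP j).2 (f j)
    refine ⟨∑ j, single j (z j), ?_⟩
    simp only [map_sum, hsingle, hz]
    exact Finset.univ_sum_single f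

end Internal

namespace GrModule

variable {Γ : Type x} [AddCommGroup Γ] [DecidableEq Γ]
variable {A : Type u} [Ring A] {σ : Type y} [SetLike σ A] [AddSubgroupClass σ A]

section Constructions

/-- The ring `A` as a graded right module over itself. -/
def regular (𝒜 : Γ → σ) [GradedRing 𝒜] : GrModule 𝒜 where
  carrier := A
  deg i := AddSubgroup.ofClass (𝒜 i)
  isInternal := DirectSum.Decomposition.isInternal 𝒜
  smul_mem hm ha := SetLike.mul_mem_graded hm ha

variable {𝒜 : Γ → σ} [GradedRing 𝒜]

/-- The direct sum of a finite family of graded modules. -/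
def pi {ι : Type u} [Finite ι] (M : ι → GrModule 𝒜) : GrModule 𝒜 where
  carrier := ∀ j, (M j).carrier
  deg i := AddSubgroup.pi Set.univ fun j => (M j).deg i
  isInternal := isInternal_pi fun j => (M j).isInternal
  smul_mem hm ha j _ := (M j).smul_mem (hm j trivial) ha

/-- The graded free module with a finite basis indexed by `ι`, placed in degree `k`. -/
abbrev free (𝒜 : Γ → σ) [GradedRing 𝒜] (k : Γ) (ι : Type u) [Finite ι] : GrModule 𝒜 :=
  pi fun _ : ι => (regular 𝒜).shift (-k)

/-- The image of a graded idempotent endomorphism. -/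
def ofIdempotent (M : GrModule 𝒜) (e : M.carrier →ₗ[Aᵐᵒᵖ] M.carrier) (he : IsGradedHom e)
    (hee : e ∘ₗ e = e) : GrModule 𝒜 where
  carrier := LinearMap.range e
  deg i := (M.deg i).comap (LinearMap.range e).subtype.toAddMonoidHom
  isInternal := isInternal_of_retract M.isInternal (LinearMap.range e).subtype.toAddMonoidHom
    e.rangeRestrict.toAddMonoidHom (fun _ _ hn => hn) (fun i _ hm => he i _ hm) <| by
      rintro ⟨_, m, rfl⟩
      exact Subtype.ext (LinearMap.congr_fun hee m)
  smul_mem hm ha := M.smul_mem hm ha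

end Constructions

variable {𝒜 : Γ → σ} [GradedRing 𝒜]

theorem exists_mem_deg_of_isGradedHom {M N : GrModule 𝒜} {g : M.carrier →ₗ[Aᵐᵒᵖ] N.carrier}
    (hg : IsGradedHom g) {k : Γ} {m : M.carrier} (hm : g m ∈ N.deg k) :
    ∃ m' ∈ M.deg k, g m' = g m := by
  obtain ⟨z, hz⟩ := M.isInternal.2 m
  obtain ⟨g', hg', hg'_apply⟩ := exists_directSum_map (g : M.carrier →+ N.carrier) hg
  have hg'z : g' z = DirectSum.of (fun i => N.deg i) k ⟨g m, hm⟩ :=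
    N.isInternal.1 <| by rw [hg', hz]; simp
  exact ⟨z k, (z k).2, (hg'_apply z k).symm.trans (by simp [hg'z])⟩

end GrModule

/-! ### Frames of graded modules and their Gram matrices -/

open scoped RightActions in
/-- The right linear map `a ↦ ∑ j, m j a j` given by a finite family of vectors. -/
def rightLinearCombination {A M ι : Type*} [Semiring A] [AddCommMonoid M] [Module Aᵐᵒᵖ M]
    [Fintype ι] (m : ι → M) : (ι → A) →ₗ[Aᵐᵒᵖ] M where
  toFun a := ∑ j, m j <• a j
  map_add' a b := by
    simp only [Pi.add_apply, MulOpposite.op_add, add_smul, Finset.sum_add_distrib]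
  map_smul' c a := by
    simp only [Pi.smul_apply, Finset.smul_sum, smul_smul, RingHom.id_apply]
    rfl

theorem rightLinearCombination_single {A M ι : Type*} [Semiring A] [AddCommMonoid M]
    [Module Aᵐᵒᵖ M] [Fintype ι] [DecidableEq ι] (m : ι → M) (j : ι) :
    rightLinearCombination m (Pi.single j (1 : A)) = m j := by
  simp [rightLinearCombination, Pi.single_apply, apply_ite MulOpposite.op, ite_smul]

namespace GrModule

open scoped RightActions

variable {Γ : Type x} [AddCommGroup Γ] [DecidableEq Γ]
variable {A : Type u} [Ring A] {σ : Type y} [SetLike σ A] [AddSubgroupClass σ A]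
variable {𝒜 : Γ → σ} [GradedRing 𝒜] {P Q : GrModule 𝒜} {k : Γ} {ι κ : Type*}
variable [Fintype ι] [Fintype κ]

theorem rightLinearCombination_mem_deg {m : ι → P.carrier} (hm : ∀ j, m j ∈ P.deg k)
    {i : Γ} {a : ι → A} (ha : ∀ j, a j ∈ 𝒜 (-k + i)) :
    rightLinearCombination m a ∈ P.deg i :=
  sum_mem fun j _ => by simpa using P.smul_mem (hm j) (ha j)

/-- A frame of degree `k` of a graded module: finitely many vectors of degree `k`, together with
homogeneous coordinate functionals which express every element as a combination of these vectors.
Neither the vectors nor the functionals have to be independent, so a frame presents the module as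
a graded direct summand of a free module with basis in degree `k`. -/
structure Frame (P : GrModule 𝒜) (k : Γ) (ι : Type*) [Fintype ι] where
  vec : ι → P.carrier
  coord : ι → P.carrier →ₗ[Aᵐᵒᵖ] A
  vec_mem : ∀ j, vec j ∈ P.deg k
  coord_mem : ∀ j {i : Γ} {m : P.carrier}, m ∈ P.deg i → coord j m ∈ 𝒜 (-k + i)
  sum_vec_coord : ∀ m, ∑ j, vec j <• coord j m = m

namespace Frame

/-- The matrix of the coordinates in one frame of the vectors of another frame. -/
def transition (F : Frame P k ι) (F' : Frame P k κ) : Matrix ι κ A :=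
  .of fun i j => F.coord i (F'.vec j)

/-- The matrix of the coordinates of the vectors of a frame in the frame itself: the idempotent
matrix over `𝒜 0` that corresponds to the direct summand `P` of a free module. -/
def gram (F : Frame P k ι) : Matrix ι ι A := F.transition F

theorem transition_mem (F : Frame P k ι) (F' : Frame P k κ) (i : ι) (j : κ) :
    F.transition F' i j ∈ 𝒜 0 := by
  simpa only [neg_add_cancel] using! F.coord_mem i (F'.vec_mem j)

theorem transition_mulVec_coord (F : Frame P k ι) (F' : Frame P k κ) (m : P.carrier) :
    (F.transition F' *ᵥ fun j => F'.coord j m) = fun i => F.coord i m := by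
  ext i
  conv_rhs => rw [← F'.sum_vec_coord m]
  simp [Matrix.mulVec, dotProduct, transition]

theorem transition_mul_transition {ι' : Type*} [Fintype ι'] (F : Frame P k ι) (F' : Frame P k κ)
    (F'' : Frame P k ι') : F.transition F' * F'.transition F'' = F.transition F'' := by
  ext i j
  exact congrFun (F.transition_mulVec_coord F' (F''.vec j)) i

theorem isIdempotentElem_gram (F : Frame P k ι) : IsIdempotentElem F.gram :=
  F.transition_mul_transition F F

section Operations

/-- A graded direct summand inherits the frames of the module. -/
def retract (F : Frame P k ι) (s : Q.carrier →ₗ[Aᵐᵒᵖ] P.carrier)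
    (p : P.carrier →ₗ[Aᵐᵒᵖ] Q.carrier) (hs : IsGradedHom s) (hp : IsGradedHom p)
    (hps : p ∘ₗ s = LinearMap.id) : Frame Q k ι where
  vec j := p (F.vec j)
  coord j := F.coord j ∘ₗ s
  vec_mem j := hp _ _ (F.vec_mem j)
  coord_mem j _ _ hm := F.coord_mem j (hs _ _ hm)
  sum_vec_coord m := by
    have h := congrArg p (F.sum_vec_coord (s m))
    rw [← LinearMap.comp_apply, hps] at h
    simpa using h

/-- The frame of `P ⊕ Q` given by frames of `P` and of `Q`. -/
def prod (F : Frame P k ι) (F' : Frame Q k κ) : Frame (P.prod Q) k (ι ⊕ κ) where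
  vec := Sum.elim (fun i => ((F.vec i, 0) : P.carrier × Q.carrier)) fun j => (0, F'.vec j)
  coord := Sum.elim (fun i => F.coord i ∘ₗ LinearMap.fst Aᵐᵒᵖ P.carrier Q.carrier)
    fun j => F'.coord j ∘ₗ LinearMap.snd Aᵐᵒᵖ P.carrier Q.carrier
  vec_mem := Sum.rec (fun i => ⟨F.vec_mem i, (Q.deg k).zero_mem⟩)
    fun j => ⟨(P.deg k).zero_mem, F'.vec_mem j⟩
  coord_mem := Sum.rec (fun i _ _ hm => F.coord_mem i hm.1) fun j _ _ hm => F'.coord_mem j hm.2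
  sum_vec_coord := by
    rintro ⟨p, q⟩
    rw [Fintype.sum_sum_type]
    change (∑ i, ((F.vec i, 0) : P.carrier × Q.carrier) <• F.coord i p) +
      ∑ j, ((0, F'.vec j) : P.carrier × Q.carrier) <• F'.coord j q = (p, q)
    ext <;> simp [Prod.fst_sum, Prod.snd_sum, F.sum_vec_coord, F'.sum_vec_coord]

theorem gram_prod (F : Frame P k ι) (F' : Frame Q k κ) :
    (F.prod F').gram = Matrix.fromBlocks F.gram 0 0 F'.gram := by
  ext (i | i) (j | j)
  exacts [rfl, map_zero (F.coord i), map_zero (F'.coord i), rfl]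

/-- A frame of `P`, with its degree shifted, as a frame of `P(δ)`. -/
def shift (F : Frame P k ι) {δ l : Γ} (h : δ + l = k) : Frame (P.shift δ) l ι where
  vec := F.vec
  coord := F.coord
  vec_mem j := by
    change F.vec j ∈ P.deg (δ + l)
    exact h ▸ F.vec_mem j
  coord_mem j i m hm := by
    have hdeg : -l + i = -k + (δ + i) := by rw [← h]; abel
    exact hdeg ▸ F.coord_mem j hm
  sum_vec_coord := F.sum_vec_coord

variable {ε : Type*} [Fintype ε] {d : Γ} {a b : ε → A}

/-- The frame of degree `k + d` obtained by multiplying the vectors of a frame of degree `k` by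
elements `a e` of degree `d` such that `∑ e, a e * b e = 1`. -/
def refine (F : Frame P k ι) (ha : ∀ e, a e ∈ 𝒜 d) (hb : ∀ e, b e ∈ 𝒜 (-d))
    (hab : ∑ e, a e * b e = 1) : Frame P (k + d) (ι × ε) where
  vec i := F.vec i.1 <• a i.2
  coord i := LinearMap.mulLeft Aᵐᵒᵖ (b i.2) ∘ₗ F.coord i.1
  vec_mem i := P.smul_mem (F.vec_mem i.1) (ha i.2)
  coord_mem i j m hm := by
    have h := SetLike.mul_mem_graded (hb i.2) (F.coord_mem i.1 hm)
    have hdeg : -(k + d) + j = -d + (-k + j) := by abel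
    exact hdeg ▸ h
  sum_vec_coord m := by
    simp_rw [LinearMap.comp_apply, LinearMap.mulLeft_apply, op_smul_op_smul, ← mul_assoc]
    simp_rw [Fintype.sum_prod_type, ← Finset.sum_smul, ← Finset.op_sum, ← Finset.sum_mul, hab,
      one_mul, F.sum_vec_coord]

theorem transition_refine (F : Frame P k ι) (F' : Frame P k κ) (ha : ∀ e, a e ∈ 𝒜 d)
    (hb : ∀ e, b e ∈ 𝒜 (-d)) (hab : ∑ e, a e * b e = 1) (i : ι × ε) (j : κ × ε) :
    (F.refine ha hb hab).transition (F'.refine ha hb hab) i j =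
      b i.2 * F.transition F' i.1 j.1 * a j.2 := by
  change b i.2 * F.coord i.1 (F'.vec j.1 <• a j.2) = _
  rw [map_smul, mul_assoc]
  rfl

end Operations

theorem isFG (F : Frame P k ι) : P.IsFG := by
  refine ⟨Submodule.fg_def.2 ⟨_, Set.finite_range F.vec, ?_⟩⟩
  refine top_le_iff.1 fun m _ => ?_
  rw [← F.sum_vec_coord m]
  exact sum_mem fun j _ => Submodule.smul_mem _ _ (Submodule.subset_span ⟨j, rfl⟩)

theorem isGradedProjective (F : Frame P k ι) : P.IsGradedProjective := by
  intro M N g f hg hsurj hf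
  choose m₀ hm₀ using fun j => hsurj (f (F.vec j))
  choose m hm hgm using fun j =>
    exists_mem_deg_of_isGradedHom hg (hm₀ j ▸ hf _ _ (F.vec_mem j))
  refine ⟨rightLinearCombination m ∘ₗ LinearMap.pi F.coord,
    fun i p hp => rightLinearCombination_mem_deg hm fun j => F.coord_mem j hp, ?_⟩
  ext p
  conv_rhs => rw [← F.sum_vec_coord p]
  simp [rightLinearCombination, hgm, hm₀]

/-- The right linear map which has the matrix `U` with respect to the given frames. -/
def toLin (F : Frame P k ι) (F' : Frame Q k κ) (U : Matrix κ ι A) :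
    P.carrier →ₗ[Aᵐᵒᵖ] Q.carrier :=
  rightLinearCombination F'.vec ∘ₗ Matrix.mulVecBilin A Aᵐᵒᵖ U ∘ₗ LinearMap.pi F.coord

theorem isGradedHom_toLin (F : Frame P k ι) (F' : Frame Q k κ) {U : Matrix κ ι A}
    (hU : ∀ i j, U i j ∈ 𝒜 0) : IsGradedHom (F.toLin F' U) := fun i m hm =>
  rightLinearCombination_mem_deg F'.vec_mem fun j => sum_mem fun l _ => by
    simpa only [zero_add] using! SetLike.mul_mem_graded (hU j l) (F.coord_mem l hm)

theorem coord_toLin (F : Frame P k ι) (F' : Frame Q k κ) (U : Matrix κ ι A) (m : P.carrier) :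
    (fun j => F'.coord j (F.toLin F' U m)) = F'.gram *ᵥ U *ᵥ fun i => F.coord i m := by
  ext j
  simp [toLin, rightLinearCombination, gram, transition, Matrix.mulVec, dotProduct]

theorem toLin_toLin (F : Frame P k ι) (F' : Frame Q k κ) {W : Matrix ι κ A} {U : Matrix κ ι A}
    (hWU : W * U = F.gram) (hUW : U * W = F'.gram) (m : P.carrier) :
    F'.toLin F W (F.toLin F' U m) = m := by
  have hcoord : (W *ᵥ fun j => F'.coord j (F.toLin F' U m)) = fun i => F.coord i m := by
    rw [F.coord_toLin, ← hUW]
    simp only [Matrix.mulVec_mulVec, ← Matrix.mul_assoc, hWU]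
    rw [Matrix.mul_assoc, hWU, F.isIdempotentElem_gram.eq]
    exact F.transition_mulVec_coord F m
  exact (congrArg (rightLinearCombination F.vec) hcoord).trans (F.sum_vec_coord m)

theorem isIso_of_mul_eq_gram (F : Frame P k ι) (F' : Frame Q k κ) {W : Matrix ι κ A}
    {U : Matrix κ ι A} (hU : ∀ i j, U i j ∈ 𝒜 0)
    (hWU : W * U = F.gram) (hUW : U * W = F'.gram) : P.IsIso Q :=
  ⟨.ofLinearMap (F.toLin F' U) (F'.toLin F W) (LinearMap.ext (F'.toLin_toLin F hUW hWU))
    (LinearMap.ext (F.toLin_toLin F' hWU hUW)), F.isGradedHom_toLin F' hU⟩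

end Frame

section Existence

variable {ι : Type u} [Fintype ι]

/-- The standard basis of a graded free module as a frame. -/
def freeFrame (𝒜 : Γ → σ) [GradedRing 𝒜] (k : Γ) (ι : Type u) [Fintype ι] [DecidableEq ι] :
    Frame (free 𝒜 k ι) k ι where
  vec j := Pi.single (M := fun _ => A) j 1
  coord j := LinearMap.proj (φ := fun _ => A) j
  vec_mem j := (AddSubgroup.single_mem_pi (f := fun _ => A) _ _).2 fun _ => by
    change (1 : A) ∈ 𝒜 (-k + k)
    simpa using SetLike.one_mem_graded 𝒜
  coord_mem j _ _ hm := hm j trivial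
  sum_vec_coord := fun m : ι → A => by
    change ∑ j, (Pi.single j 1 : ι → A) <• m j = m
    ext i
    simp [Pi.single_apply]

theorem exists_frame_of_span_deg_eq_top (hP : P.IsFG) (hproj : P.IsGradedProjective)
    (hk : Submodule.span Aᵐᵒᵖ (P.deg k : Set P.carrier) = ⊤) :
    ∃ s : Finset P.carrier, Nonempty (Frame P k s) := by
  classical
  obtain ⟨s, hs, hspan⟩ := (Submodule.fg_span_iff_fg_span_finset_subset _).1
    (hk.symm ▸ hP.fg_top)
  let g : (free 𝒜 k s).carrier →ₗ[Aᵐᵒᵖ] P.carrier :=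
    rightLinearCombination (Subtype.val : s → P.carrier)
  have hg : IsGradedHom g := fun i m hm =>
    rightLinearCombination_mem_deg (fun j => hs j.2) fun j => hm j trivial
  have hsurj : Function.Surjective g := by
    rw [← LinearMap.range_eq_top, ← top_le_iff, ← hk, hspan, Submodule.span_le]
    intro m hm
    exact ⟨Pi.single (M := fun _ => A) ⟨m, hm⟩ 1, rightLinearCombination_single _ _⟩
  obtain ⟨h, hh, hgh⟩ := hproj _ P g LinearMap.id hg hsurj fun _ _ hm => hm
  exact ⟨s, ⟨(freeFrame 𝒜 k s).retract h g hh hg hgh⟩⟩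

theorem exists_frame_gram_eq (k : Γ) {e : Matrix ι ι A} (he : IsIdempotentElem e)
    (he₀ : ∀ i j, e i j ∈ 𝒜 0) : ∃ (P : GrModule 𝒜) (F : Frame P k ι), F.gram = e := by
  classical
  let f : (free 𝒜 k ι).carrier →ₗ[Aᵐᵒᵖ] (free 𝒜 k ι).carrier := Matrix.mulVecBilin A Aᵐᵒᵖ e
  have hf : IsGradedHom f := fun i m hm j _ => sum_mem fun l _ => by
    simpa only [zero_add] using! SetLike.mul_mem_graded (he₀ j l) (hm l trivial)
  have hff : f ∘ₗ f = f := LinearMap.ext fun m : ι → A => by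
    change e *ᵥ e *ᵥ m = e *ᵥ m
    rw [Matrix.mulVec_mulVec, he.eq]
  let P := ofIdempotent _ f hf hff
  let s : P.carrier →ₗ[Aᵐᵒᵖ] (free 𝒜 k ι).carrier := (LinearMap.range f).subtype
  refine ⟨P, (freeFrame 𝒜 k ι).retract s f.rangeRestrict (fun _ _ hm => hm) hf ?_, ?_⟩
  · ext ⟨_, m, rfl⟩
    exact Subtype.ext (LinearMap.congr_fun hff m)
  · ext i j
    exact congrFun (Matrix.mulVec_single_one e j) i

end Existence

end GrModule

/-! ### Ranks of matrices over a power of a field -/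

section PointwiseRank

variable {V K : Type*} [Field K] {ι κ : Type*} [Fintype ι] [Fintype κ]

/-- The ranks of the components of a matrix over `K ^ V`, a complete invariant of Murray–von Neumann
equivalence of idempotent matrices. They are integers because the graph acts on them by its
adjacency matrix. -/
noncomputable def pointwiseRank (g : Matrix ι ι (V → K)) (u : V) : ℤ :=
  (g.map (Pi.evalRingHom (fun _ => K) u)).rank

theorem pointwiseRank_nonneg (g : Matrix ι ι (V → K)) : 0 ≤ pointwiseRank g :=
  fun _ => Nat.cast_nonneg _

theorem isIdempotentElem_matrix_map {R S : Type*} [Semiring R] [Semiring S] {g : Matrix ι ι R}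
    (hg : IsIdempotentElem g) (f : R →+* S) : IsIdempotentElem (g.map f) := by
  classical
  exact hg.map f.mapMatrix

theorem MvNEquiv.pointwiseRank_eq {g : Matrix ι ι (V → K)} {g' : Matrix κ κ (V → K)}
    (h : MvNEquiv g g') (hg : IsIdempotentElem g) (hg' : IsIdempotentElem g') :
    pointwiseRank g = pointwiseRank g' :=
  funext fun _ => congrArg Nat.cast <|
    (h.map _).rank_eq (isIdempotentElem_matrix_map hg _) (isIdempotentElem_matrix_map hg' _)

theorem MvNEquiv.of_pointwiseRank_eq {g : Matrix ι ι (V → K)} {g' : Matrix κ κ (V → K)}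
    (hg : IsIdempotentElem g) (hg' : IsIdempotentElem g')
    (h : pointwiseRank g = pointwiseRank g') : MvNEquiv g g' :=
  .pi fun u => .of_rank_eq (isIdempotentElem_matrix_map hg _) (isIdempotentElem_matrix_map hg' _)
    (Nat.cast_injective (congrFun h u))

theorem pointwiseRank_diagonal [DecidableEq ι] [DecidableEq K] (d : ι → V → K) (v : V) :
    pointwiseRank (Matrix.diagonal d) v = Fintype.card {i // d i v ≠ 0} := by
  rw [pointwiseRank, Matrix.diagonal_map (map_zero _), Matrix.rank_diagonal]
  rfl

theorem pointwiseRank_fromBlocks {g : Matrix ι ι (V → K)} {g' : Matrix κ κ (V → K)}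
    (hg : IsIdempotentElem g) (hg' : IsIdempotentElem g') :
    pointwiseRank (Matrix.fromBlocks g 0 0 g') = pointwiseRank g + pointwiseRank g' := by
  ext u
  simp only [pointwiseRank, Matrix.fromBlocks_map, Matrix.map_zero _ (map_zero _), Pi.add_apply]
  rw [rank_fromBlocks_of_isIdempotentElem (isIdempotentElem_matrix_map hg _)
    (isIdempotentElem_matrix_map hg' _), Nat.cast_add]

end PointwiseRank

/-! ### Comparison of frames -/

namespace GrModule

section Transition

variable {Γ : Type x} [AddCommGroup Γ] [DecidableEq Γ]
variable {A : Type u} [Ring A] {σ : Type y} [SetLike σ A] [AddSubgroupClass σ A]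
variable {𝒜 : Γ → σ} [GradedRing 𝒜] {P Q : GrModule 𝒜} {k : Γ} {ι κ : Type*}
variable [Fintype ι] [Fintype κ] {B Φ : Type*} [Ring B] [FunLike Φ B A]
variable [RingHomClass Φ B A] {φ : Φ}
variable {g : Matrix ι ι B} {g' : Matrix κ κ B}

theorem Frame.isIdempotentElem_of_gram_eq_map (F : Frame P k ι) (hφ : Function.Injective φ)
    (hg : F.gram = g.map φ) : IsIdempotentElem g := by
  apply Matrix.map_injective hφ
  beta_reduce
  rw [Matrix.map_mul, ← hg, F.isIdempotentElem_gram.eq]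

theorem Frame.mvNEquiv_of_transition_mem_range (F : Frame P k ι) (F' : Frame P k κ)
    (hφ : Function.Injective φ) (hg : F.gram = g.map φ) (hg' : F'.gram = g'.map φ)
    (h : ∀ i j, F.transition F' i j ∈ Set.range φ) (h' : ∀ i j, F'.transition F i j ∈ Set.range φ) :
    MvNEquiv g g' := by
  choose W hW using h
  choose U hU using h'
  have hW' : (Matrix.of W).map φ = F.transition F' := Matrix.ext hW
  have hU' : (Matrix.of U).map φ = F'.transition F := Matrix.ext hU
  refine ⟨.of W, .of U, Matrix.map_injective hφ ?_, Matrix.map_injective hφ ?_⟩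
  · beta_reduce
    rw [Matrix.map_mul, hW', hU', F.transition_mul_transition, ← hg, gram]
  · beta_reduce
    rw [Matrix.map_mul, hU', hW', F'.transition_mul_transition, ← hg', gram]

theorem Frame.isIso_of_mvNEquiv (F : Frame P k ι) (F' : Frame Q k κ) (hφ : ∀ x, φ x ∈ 𝒜 0)
    (hg : F.gram = g.map φ) (hg' : F'.gram = g'.map φ) (h : MvNEquiv g g') : P.IsIso Q := by
  obtain ⟨W, U, rfl, rfl⟩ := h
  exact F.isIso_of_mul_eq_gram F' (W := W.map φ) (U := U.map φ) (fun i j => hφ _)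
    (by rw [hg, Matrix.map_mul]) (by rw [hg', Matrix.map_mul])

end Transition

/-! ### Degrees in which a module is generated -/

section SpanDeg

open scoped RightActions

variable {A : Type u} [Ring A] {σ : Type y} [SetLike σ A] [AddSubgroupClass σ A]
variable {𝒜 : ℤ → σ} [GradedRing 𝒜] {P : GrModule 𝒜}

theorem monotone_span_deg (P : GrModule 𝒜) {ε : Type*} [Fintype ε] {a b : ε → A}
    (ha : ∀ e, a e ∈ 𝒜 1) (hab : ∑ e, a e * b e = 1) :
    Monotone fun k : ℤ => Submodule.span Aᵐᵒᵖ (P.deg k : Set P.carrier) := by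
  refine monotone_int_of_le_succ fun k => Submodule.span_le.2 fun m hm => ?_
  have hsum : m = ∑ e, (m <• a e) <• b e := by
    simp_rw [op_smul_op_smul, ← Finset.sum_smul, ← Finset.op_sum, hab, MulOpposite.op_one,
      one_smul]
  rw [SetLike.mem_coe, hsum]
  exact sum_mem fun e _ => Submodule.smul_mem _ _
    (Submodule.subset_span (P.smul_mem hm (ha e)))

theorem exists_mem_span_deg
    (hmono : Monotone fun k : ℤ => Submodule.span Aᵐᵒᵖ (P.deg k : Set P.carrier))
    (m : P.carrier) : ∃ k, m ∈ Submodule.span Aᵐᵒᵖ (P.deg k : Set P.carrier) := by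
  obtain ⟨z, rfl⟩ := P.isInternal.2 m
  induction z using DirectSum.induction_on with
  | zero => exact ⟨0, by simp only [map_zero, zero_mem]⟩
  | of i p =>
    refine ⟨i, Submodule.subset_span ?_⟩
    rw [DirectSum.coeAddMonoidHom_of]
    exact p.2
  | add y z hy hz =>
    obtain ⟨i, hi⟩ := hy
    obtain ⟨j, hj⟩ := hz
    refine ⟨max i j, ?_⟩
    rw [map_add]
    exact add_mem (hmono (le_max_left i j) hi) (hmono (le_max_right i j) hj)

theorem IsFG.eventually_span_deg_eq_top (hP : P.IsFG)
    (hmono : Monotone fun k : ℤ => Submodule.span Aᵐᵒᵖ (P.deg k : Set P.carrier)) :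
    ∀ᶠ k in Filter.atTop, Submodule.span Aᵐᵒᵖ (P.deg k : Set P.carrier) = ⊤ := by
  obtain ⟨s, hs⟩ := hP.fg_top
  choose f hf using exists_mem_span_deg hmono
  have h : ∀ᶠ k in Filter.atTop, ∀ m ∈ s, f m ≤ k :=
    s.eventually_all.2 fun m _ => Filter.eventually_ge_atTop (f m)
  filter_upwards [h] with k hk
  exact top_le_iff.1 (hs ▸ Submodule.span_le.2 fun m hm => hmono (hk m hm) (hf m))

end SpanDeg

end GrModule

/-! ### Generators and relations of the Leavitt path algebra -/

namespace LPA

open LPAGen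

section Generators

variable {V : Type u} {E : Type v} [Fintype V] [Fintype E] [DecidableEq V]
variable (K : Type w) [Field K] (G : DirectedGraph V E)

/-- The vertex `v` as an element of the Leavitt path algebra. -/
noncomputable def vx (v : V) : LPA K G := gen K G (vertex v)

/-- The edge `α` as an element of the Leavitt path algebra. -/
noncomputable def ed (e : E) : LPA K G := gen K G (edge e)

/-- The ghost edge `α*` as an element of the Leavitt path algebra. -/
noncomputable def gh (e : E) : LPA K G := gen K G (ghost e)

theorem vx_mem_grading (v : V) : vx K G v ∈ grading K G 0 := gen_mem K G (vertex v)

theorem ed_mem_grading (e : E) : ed K G e ∈ grading K G 1 := gen_mem K G (edge e)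

theorem gh_mem_grading (e : E) : gh K G e ∈ grading K G (-1) := gen_mem K G (ghost e)

theorem completeOrthogonalIdempotents_vx : CompleteOrthogonalIdempotents (vx K G) where
  idem v := by
    simpa only [map_mul] using! RingQuot.mkAlgHom_rel K (LPARel.vertex_mul_self (G := G) v)
  ortho v w h := by
    simpa only [map_mul, map_zero] using!
      RingQuot.mkAlgHom_rel K (LPARel.vertex_mul_of_ne (G := G) v w h)
  complete := by
    simpa only [map_sum, map_one] using! RingQuot.mkAlgHom_rel K (LPARel.sum_vertex (G := G))

theorem vx_mul_vx (v w : V) : vx K G v * vx K G w = if v = w then vx K G v else 0 :=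
  (completeOrthogonalIdempotents_vx K G).mul_eq v w

theorem gh_mul_vx (e : E) (v : V) :
    gh K G e * vx K G v = if G.s e = v then gh K G e else 0 := by
  have h : gh K G e * vx K G (G.s e) = gh K G e := by
    simpa only [map_mul] using! RingQuot.mkAlgHom_rel K (LPARel.ghost_mul_source (G := G) e)
  conv_lhs => rw [← h, mul_assoc, vx_mul_vx]
  rw [mul_ite, h, mul_zero]

theorem gh_mul_ed [DecidableEq E] (e f : E) :
    gh K G e * ed K G f = if e = f then vx K G (G.r e) else 0 := by
  split_ifs with h
  · subst h
    simpa only [map_mul] using! RingQuot.mkAlgHom_rel K (LPARel.ghost_mul_edge (G := G) e)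
  · simpa only [map_mul, map_zero] using!
      RingQuot.mkAlgHom_rel K (LPARel.ghost_mul_edge_of_ne (G := G) e f h)

theorem sum_ed_mul_gh {G : DirectedGraph V E} (hG : G.NoSinks) :
    ∑ e, ed K G e * gh K G e = 1 := by
  rw [← (completeOrthogonalIdempotents_vx K G).complete, ← Finset.sum_fiberwise _ G.s]
  refine Finset.sum_congr rfl fun v _ => ?_
  simpa only [map_sum, map_mul] using!
    RingQuot.mkAlgHom_rel K (LPARel.sum_edge_mul_ghost (G := G) v (hG v))

/-- The embedding of the algebra `K ^ V` in the Leavitt path algebra as the span of the vertices,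
which are complete orthogonal idempotents. -/
noncomputable def diagHom : (V → K) →ₐ[K] LPA K G :=
  AlgHom.ofLinearMap (Fintype.linearCombination K (vx K G))
    (by simp [Fintype.linearCombination_apply, (completeOrthogonalIdempotents_vx K G).complete])
    fun f g => by
      simp [Fintype.linearCombination_apply, Finset.sum_mul_sum, vx_mul_vx, smul_smul, mul_comm]

theorem diagHom_apply (f : V → K) : diagHom K G f = ∑ v, f v • vx K G v := rfl

theorem diagHom_single (v : V) (c : K) : diagHom K G (Pi.single v c) = c • vx K G v :=
  Fintype.linearCombination_apply_single K (vx K G) v c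

theorem diagHom_mem_grading (f : V → K) : diagHom K G f ∈ grading K G 0 :=
  sum_mem fun v _ => Submodule.smul_mem _ _ (vx_mem_grading K G v)

theorem gh_mul_diagHom_mul_ed [DecidableEq E] (f : V → K) (e e' : E) :
    gh K G e * diagHom K G f * ed K G e' =
      if e = e' then f (G.s e) • vx K G (G.r e) else 0 := by
  simp [diagHom_apply, Finset.mul_sum, gh_mul_vx, gh_mul_ed]

end Generators

/-! ### A representation in which the vertices are nonzero -/

section Representation

variable {V : Type u} {E : Type v} {G : DirectedGraph V E}

theorem exists_equiv_prod_nat_of_noSinks [Finite E] (hG : G.NoSinks) :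
    ∃ θ : V × ℕ ≃ E × ℕ, ∀ x, G.s (θ x).1 = x.1 := by
  have h (v : V) : Nonempty (ℕ ≃ {e // G.s e = v} × ℕ) := by
    have : Nonempty {e // G.s e = v} := nonempty_subtype.2 (hG v)
    exact nonempty_equiv_of_countable
  let t v := Classical.choice (h v)
  refine ⟨(Equiv.sigmaEquivProd V ℕ).symm.trans <| (Equiv.sigmaCongrRight t).trans <|
    (Equiv.sigmaProdDistrib _ ℕ).symm.trans <|
      (Equiv.sigmaFiberEquiv G.s).prodCongr (Equiv.refl ℕ), fun x => ?_⟩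
  exact (t x.1 x.2).1.2

variable (K : Type w) [Field K]

/-- The operator `f ↦ f ∘ g` on functions, followed by restriction to a set and extension by
zero. -/
noncomputable def indicatorPullback {X : Type*} (s : Set X) (g : X → X) :
    Module.End K (X → K) where
  toFun f := s.indicator (f ∘ g)
  map_add' f f' := Set.indicator_add s (f ∘ g) (f' ∘ g)
  map_smul' c f := Set.indicator_const_smul s c (f ∘ g)

/-- The action of the generators on functions on `V × ℕ` determined by a bijection
`V × ℕ ≃ E × ℕ` over the source map: the edge `e` and its ghost act by mutually inverse bijections
between the points over `s e` which correspond to `e` and the points over `r e`. -/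
noncomputable def genAction (G : DirectedGraph V E) (θ : V × ℕ ≃ E × ℕ) :
    LPAGen V E → Module.End K (V × ℕ → K)
  | vertex v => indicatorPullback K {x | x.1 = v} id
  | edge e => indicatorPullback K {x | (θ x).1 = e} fun x => (G.r e, (θ x).2)
  | ghost e => indicatorPullback K {x | x.1 = G.r e} fun x => θ.symm (e, x.2)

variable {θ : V × ℕ ≃ E × ℕ}

open Classical in
theorem genAction_vertex_apply (v : V) (f : V × ℕ → K) (x : V × ℕ) :
    genAction K G θ (vertex v) f x = if x.1 = v then f x else 0 := by
  rfl

open Classical in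
theorem genAction_edge_apply (e : E) (f : V × ℕ → K) (x : V × ℕ) :
    genAction K G θ (edge e) f x = if (θ x).1 = e then f (G.r e, (θ x).2) else 0 := by
  rfl

open Classical in
theorem genAction_ghost_apply (e : E) (f : V × ℕ → K) (x : V × ℕ) :
    genAction K G θ (ghost e) f x = if x.1 = G.r e then f (θ.symm (e, x.2)) else 0 := by
  rfl

variable [Fintype V] [Fintype E] [DecidableEq V]

theorem lift_genAction_eq_of_rel (hθ : ∀ x, G.s (θ x).1 = x.1)
    {a b : FreeAlgebra K (LPAGen V E)} (h : LPARel K G a b) :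
    FreeAlgebra.lift K (genAction K G θ) a = FreeAlgebra.lift K (genAction K G θ) b := by
  classical
  have hs (e : E) (n : ℕ) : (θ.symm (e, n)).1 = G.s e := by
    rw [← hθ, Equiv.apply_symm_apply]
  refine LinearMap.ext fun f => funext fun x => ?_
  cases h <;> simp only [map_mul, map_sum, map_zero, map_one, FreeAlgebra.lift_ι_apply,
    Module.End.mul_apply, LinearMap.sum_apply, Finset.sum_apply, genAction_vertex_apply,
    genAction_edge_apply, genAction_ghost_apply, hs, Equiv.apply_symm_apply, if_true]
  case sum_edge_mul_ghost v h => simp [hθ]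
  all_goals aesop

end Representation

section Injectivity

variable {V : Type u} {E : Type v} [Fintype V] [Fintype E] [DecidableEq V]
variable (K : Type w) [Field K] {G : DirectedGraph V E}

theorem vx_ne_zero (hG : G.NoSinks) (v : V) : vx K G v ≠ 0 := by
  obtain ⟨θ, hθ⟩ := exists_equiv_prod_nat_of_noSinks hG
  let ρ : LPA K G →ₐ[K] Module.End K (V × ℕ → K) := RingQuot.liftAlgHom K
    ⟨FreeAlgebra.lift K (genAction K G θ), fun _ _ h => lift_genAction_eq_of_rel K hθ h⟩
  have hρ : ρ (vx K G v) = genAction K G θ (vertex v) := by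
    simp [ρ, vx, gen]
  intro h
  rw [h, map_zero] at hρ
  have h01 := congrFun (LinearMap.congr_fun hρ 1) (v, 0)
  simp [genAction_vertex_apply] at h01

theorem diagHom_injective (hG : G.NoSinks) : Function.Injective (diagHom K G) := by
  refine (injective_iff_map_eq_zero _).2 fun f hf => funext fun v => ?_
  have h : f v • vx K G v = 0 := by
    simpa [diagHom_apply, Finset.mul_sum, vx_mul_vx] using congrArg (vx K G v * ·) hf
  exact (smul_eq_zero.1 h).resolve_right (vx_ne_zero K hG v)

end Injectivity

end LPA

/-! ### Reduction of homogeneous elements to the diagonal -/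

namespace LPA

open LPAGen

section Level

variable {V : Type u} {E : Type v} [Fintype V] [Fintype E] [DecidableEq V]
variable {K : Type w} [Field K] {G : DirectedGraph V E}

/-- The elements which every ghost edge multiplies from the left into a given subspace. -/
noncomputable def leftResidual (W : Submodule K (LPA K G)) : Submodule K (LPA K G) :=
  ⨅ e, W.comap (LinearMap.mulLeft K (gh K G e))

/-- The elements which every edge multiplies from the right into a given subspace. -/
noncomputable def rightResidual (W : Submodule K (LPA K G)) : Submodule K (LPA K G) :=
  ⨅ e, W.comap (LinearMap.mulRight K (ed K G e))

theorem mem_leftResidual {W : Submodule K (LPA K G)} {x : LPA K G} :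
    x ∈ leftResidual W ↔ ∀ e, gh K G e * x ∈ W := by
  simp [leftResidual]

theorem mem_rightResidual {W : Submodule K (LPA K G)} {x : LPA K G} :
    x ∈ rightResidual W ↔ ∀ e, x * ed K G e ∈ W := by
  simp [rightResidual]

theorem monotone_leftResidual : Monotone (leftResidual (K := K) (G := G)) :=
  fun _ _ h _ hx => mem_leftResidual.2 fun e => h (mem_leftResidual.1 hx e)

theorem monotone_rightResidual : Monotone (rightResidual (K := K) (G := G)) :=
  fun _ _ h _ hx => mem_rightResidual.2 fun e => h (mem_rightResidual.1 hx e)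

theorem commute_leftResidual_rightResidual :
    Function.Commute (leftResidual (K := K) (G := G)) rightResidual := fun W => by
  ext x
  simp only [mem_leftResidual, mem_rightResidual, mul_assoc]
  exact forall_comm

variable (K G) in
/-- The elements `x` such that `p* x q` is a combination of vertices for all paths `p` of length `m`
and `q` of length `n`. -/
noncomputable def level (m n : ℕ) : Submodule K (LPA K G) :=
  leftResidual^[m] (rightResidual^[n] (diagHom K G).range.toSubmodule)

theorem mem_level_zero {x : LPA K G} : x ∈ level K G 0 0 ↔ x ∈ Set.range (diagHom K G) :=
  Iff.rfl

theorem level_succ_left (m n : ℕ) : level K G (m + 1) n = leftResidual (level K G m n) :=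
  Function.iterate_succ_apply' ..

theorem level_succ_right (m n : ℕ) : level K G m (n + 1) = rightResidual (level K G m n) := by
  rw [level, Function.iterate_succ_apply', commute_leftResidual_rightResidual.iterate_left m]
  rfl

theorem level_le_level_succ (m n : ℕ) : level K G m n ≤ level K G (m + 1) (n + 1) := by
  classical
  induction m with
  | zero =>
    induction n with
    | zero =>
      rintro _ ⟨f, rfl⟩
      rw [level_succ_left, level_succ_right]
      refine mem_leftResidual.2 fun e => mem_rightResidual.2 fun e' => ?_
      change gh K G e * diagHom K G f * ed K G e' ∈ Set.range (diagHom K G)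
      rw [gh_mul_diagHom_mul_ed]
      split_ifs
      exacts [⟨_, diagHom_single K G _ _⟩, ⟨0, map_zero _⟩]
    | succ n ih =>
      rw [level_succ_right, level_succ_right]
      exact monotone_rightResidual ih
  | succ m ih =>
    rw [level_succ_left, level_succ_left]
    exact monotone_leftResidual ih

theorem vx_mul_mem_level {m n : ℕ} {x : LPA K G} (hx : x ∈ level K G m n) (v : V) :
    vx K G v * x ∈ level K G m n := by
  induction m generalizing x with
  | zero =>
    induction n generalizing x with
    | zero =>
      obtain ⟨f, rfl⟩ := hx
      refine ⟨Pi.single v 1 * f, ?_⟩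
      simp [diagHom_single]
    | succ n ih =>
      rw [level_succ_right, mem_rightResidual] at hx ⊢
      exact fun e => mul_assoc (vx K G v) x _ ▸ ih (hx e)
  | succ m =>
    rw [level_succ_left, mem_leftResidual] at hx ⊢
    intro e
    rw [← mul_assoc, gh_mul_vx, ite_mul, zero_mul]
    split_ifs
    exacts [hx e, zero_mem _]

theorem gh_mul_mem_level {m n : ℕ} {x : LPA K G} (hx : x ∈ level K G (m + 1) n) (e : E) :
    gh K G e * x ∈ level K G m n :=
  mem_leftResidual.1 (level_succ_left (K := K) (G := G) m n ▸ hx) e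

theorem mul_ed_mem_level {m n : ℕ} {x : LPA K G} (hx : x ∈ level K G m (n + 1)) (e : E) :
    x * ed K G e ∈ level K G m n :=
  mem_rightResidual.1 (level_succ_right (K := K) (G := G) m n ▸ hx) e

theorem ed_mul_mem_level {m n : ℕ} {x : LPA K G} (hx : x ∈ level K G m n) (e : E) :
    ed K G e * x ∈ level K G (m + 1) n := by
  classical
  rw [level_succ_left]
  refine mem_leftResidual.2 fun e' => ?_
  rw [← mul_assoc, gh_mul_ed, ite_mul, zero_mul]
  split_ifs
  exacts [vx_mul_mem_level hx _, zero_mem _]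

theorem exists_prod_gen_mem_level (l : List (LPAGen V E)) :
    ∃ m n : ℕ, (m : ℤ) = n + (l.map degree).sum ∧ (l.map (gen K G)).prod ∈ level K G m n := by
  induction l with
  | nil => exact ⟨0, 0, rfl, 1, map_one _⟩
  | cons g l ih =>
    obtain ⟨m, n, hmn, hl⟩ := ih
    simp only [List.map_cons, List.sum_cons, List.prod_cons]
    cases g with
    | vertex v => exact ⟨m, n, by simpa [degree] using hmn, vx_mul_mem_level hl v⟩
    | edge e => exact ⟨m + 1, n, by simp [degree]; omega, ed_mul_mem_level hl e⟩
    | ghost e =>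
      exact ⟨m, n + 1, by simp [degree]; omega, gh_mul_mem_level (level_le_level_succ m n hl) e⟩

variable (K G) in
theorem monotone_level_self : Monotone fun n => level K G n n :=
  monotone_nat_of_le_succ fun n => level_le_level_succ n n

theorem eventually_mem_level {x : LPA K G} (hx : x ∈ grading K G 0) :
    ∀ᶠ n in Filter.atTop, x ∈ level K G n n := by
  suffices h : ∃ n, x ∈ level K G n n by
    obtain ⟨n, hn⟩ := h
    filter_upwards [Filter.eventually_ge_atTop n] with n' h using monotone_level_self K G h hn
  induction hx using Submodule.span_induction with
  | mem x h =>
    obtain ⟨l, hl, rfl⟩ := h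
    obtain ⟨m, n, hmn, hl'⟩ := exists_prod_gen_mem_level (K := K) (G := G) l
    obtain rfl : m = n := by omega
    exact ⟨m, hl'⟩
  | zero => exact ⟨0, zero_mem _⟩
  | add x y _ _ hx hy =>
    obtain ⟨m, hm⟩ := hx
    obtain ⟨n, hn⟩ := hy
    exact ⟨max m n, add_mem (monotone_level_self K G (le_max_left m n) hm)
      (monotone_level_self K G (le_max_right m n) hn)⟩
  | smul c x _ hx => exact hx.imp fun n hn => Submodule.smul_mem _ c hn

end Level

end LPA

/-! ### Vertex ranks of graded modules -/

theorem DirectedGraph.adjMatrix_transpose_mulVec {V : Type u} {E : Type v} [Fintype V] [Fintype E]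
    [DecidableEq V] (G : DirectedGraph V E) (a : V → ℤ) (u : V) :
    (G.adjMatrixᵀ *ᵥ a) u = ∑ e, if G.r e = u then a (G.s e) else 0 := by
  simp only [Matrix.mulVec, dotProduct, Matrix.transpose_apply, adjMatrix, Matrix.of_apply,
    Finset.card_eq_sum_ones, Finset.sum_filter, Nat.cast_sum, Finset.sum_mul]
  rw [Finset.sum_comm]
  refine Finset.sum_congr rfl fun e _ => ?_
  simp [ite_and]

namespace LPA

open GrModule

variable {V : Type u} {E : Type v} [Fintype V] [Fintype E] [DecidableEq V]
variable {K : Type w} [Field K] {G : DirectedGraph V E} {P Q : GrModule (grading K G)} {k : ℤ}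
variable {ι κ : Type*} [Fintype ι] [Fintype κ]

theorem isIdempotentElem_of_gram_eq_map_diagHom (hG : G.NoSinks) {F : P.Frame k ι}
    {g : Matrix ι ι (V → K)} (hg : F.gram = g.map (diagHom K G)) : IsIdempotentElem g :=
  F.isIdempotentElem_of_gram_eq_map (diagHom_injective K hG) hg

/-- Refining a frame along all edges, which form a family with `∑ e, ed e * gh e = 1`. -/
noncomputable def edgeRefine (hG : G.NoSinks) (F : P.Frame k ι) : P.Frame (k + 1) (ι × E) :=
  F.refine (ed_mem_grading K G) (gh_mem_grading K G) (sum_ed_mul_gh K hG)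

variable (G) in
/-- The effect of `edgeRefine` on a Gram matrix with entries in `K ^ V`: the component at the source
of an edge contributes a block to the component at its range. -/
def edgeBlocks [DecidableEq E] (g : Matrix ι ι (V → K)) : Matrix (ι × E) (ι × E) (V → K) :=
  .blockDiagonal fun e => g.map fun f => Pi.single (G.r e) (f (G.s e))

theorem gram_edgeRefine [DecidableEq E] (hG : G.NoSinks) {F : P.Frame k ι}
    {g : Matrix ι ι (V → K)} (hg : F.gram = g.map (diagHom K G)) :
    (edgeRefine hG F).gram = (edgeBlocks G g).map (diagHom K G) := by
  ext ⟨i, e⟩ ⟨j, e'⟩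
  have hij : F.transition F i j = diagHom K G (g i j) := congrFun (congrFun hg i) j
  rw [Frame.gram, edgeRefine, Frame.transition_refine, hij, gh_mul_diagHom_mul_ed,
    Matrix.map_apply, edgeBlocks, Matrix.blockDiagonal_apply, apply_ite (diagHom K G), map_zero,
    Matrix.map_apply, diagHom_single]

variable (G) in
theorem pointwiseRank_edgeBlocks [DecidableEq E] {g : Matrix ι ι (V → K)}
    (hg : IsIdempotentElem g) :
    pointwiseRank (edgeBlocks G g) = G.adjMatrixᵀ *ᵥ pointwiseRank g := by
  ext u
  have hblock (e : E) : (g.map fun f => (Pi.single (G.r e) (f (G.s e)) : V → K)).map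
      (Pi.evalRingHom (fun _ => K) u) =
        if G.r e = u then g.map (Pi.evalRingHom (fun _ => K) (G.s e)) else 0 := by
    ext i j
    split_ifs with h
    · simp [h]
    · simp [Ne.symm h]
  have hidem (e : E) : IsIdempotentElem
      (if G.r e = u then g.map (Pi.evalRingHom (fun _ => K) (G.s e)) else 0) := by
    split_ifs
    exacts [isIdempotentElem_matrix_map hg _, .zero]
  rw [G.adjMatrix_transpose_mulVec, pointwiseRank, edgeBlocks,
    Matrix.blockDiagonal_map _ _ (map_zero _)]
  simp only [hblock]
  rw [rank_blockDiagonal_of_isIdempotentElem hidem, Nat.cast_sum]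
  refine Finset.sum_congr rfl fun e _ => ?_
  split_ifs
  exacts [rfl, by simp]

theorem edgeRefine_transition_mem_level (hG : G.NoSinks) (F : P.Frame k ι) (F' : P.Frame k κ)
    {n : ℕ} (h : ∀ i j, F.transition F' i j ∈ level K G (n + 1) (n + 1)) (i : ι × E)
    (j : κ × E) : (edgeRefine hG F).transition (edgeRefine hG F') i j ∈ level K G n n := by
  rw [edgeRefine, edgeRefine, Frame.transition_refine]
  exact mul_ed_mem_level (gh_mul_mem_level (h i.1 j.1) i.2) j.2

theorem eventually_transition_mem_level (F : P.Frame k ι) (F' : P.Frame k κ) :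
    ∀ᶠ n in Filter.atTop, ∀ i j, F.transition F' i j ∈ level K G n n :=
  Filter.eventually_all.2 fun i => Filter.eventually_all.2 fun j =>
    eventually_mem_level (F.transition_mem F' i j)

theorem pow_mulVec_pointwiseRank_eq {ι κ : Type (max u v w)} [Fintype ι] [Fintype κ]
    (hG : G.NoSinks) {F : P.Frame k ι} {F' : P.Frame k κ}
    {g : Matrix ι ι (V → K)} {g' : Matrix κ κ (V → K)} (hg : F.gram = g.map (diagHom K G))
    (hg' : F'.gram = g'.map (diagHom K G)) {n : ℕ}
    (h : ∀ i j, F.transition F' i j ∈ level K G n n)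
    (h' : ∀ i j, F'.transition F i j ∈ level K G n n) :
    G.adjMatrixᵀ ^ n *ᵥ pointwiseRank g = G.adjMatrixᵀ ^ n *ᵥ pointwiseRank g' := by
  classical
  induction n generalizing k ι κ with
  | zero =>
    have hequiv : MvNEquiv g g' :=
      F.mvNEquiv_of_transition_mem_range F' (diagHom_injective K hG) hg hg'
        (fun i j => mem_level_zero.1 (h i j)) fun i j => mem_level_zero.1 (h' i j)
    rw [hequiv.pointwiseRank_eq (isIdempotentElem_of_gram_eq_map_diagHom hG hg)
      (isIdempotentElem_of_gram_eq_map_diagHom hG hg')]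
  | succ n ih =>
    have hrefined := ih (gram_edgeRefine hG hg) (gram_edgeRefine hG hg')
      (edgeRefine_transition_mem_level hG F F' h) (edgeRefine_transition_mem_level hG F' F h')
    rwa [pointwiseRank_edgeBlocks G (isIdempotentElem_of_gram_eq_map_diagHom hG hg),
      pointwiseRank_edgeBlocks G (isIdempotentElem_of_gram_eq_map_diagHom hG hg'),
      Matrix.mulVec_mulVec, Matrix.mulVec_mulVec, ← pow_succ] at hrefined

/-- `P` has a frame of degree `k` whose Gram matrix comes from an idempotent matrix over `K ^ V`
with ranks `a`: up to isomorphism, `P` is the direct sum of `a v` copies of the module generated by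
the vertex `v`, shifted so that the generators have degree `k`. -/
def HasVertexRank (P : GrModule (grading K G)) (k : ℤ) (a : V → ℤ) : Prop :=
  ∃ (ι : Type (max u v w)) (_ : Fintype ι) (F : P.Frame k ι) (g : Matrix ι ι (V → K)),
    F.gram = g.map (diagHom K G) ∧ pointwiseRank g = a

namespace HasVertexRank

variable {a b : V → ℤ}

theorem nonneg : HasVertexRank P k a → 0 ≤ a := by
  rintro ⟨_, _, _, g, _, rfl⟩
  exact pointwiseRank_nonneg g

theorem succ (hG : G.NoSinks) : HasVertexRank P k a →
    HasVertexRank P (k + 1) (G.adjMatrixᵀ *ᵥ a) := by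
  classical
  rintro ⟨ι, _, F, g, hg, rfl⟩
  exact ⟨ι × E, inferInstance, edgeRefine hG F, edgeBlocks G g, gram_edgeRefine hG hg,
    pointwiseRank_edgeBlocks G (isIdempotentElem_of_gram_eq_map_diagHom hG hg)⟩

theorem add_nat (hG : G.NoSinks) (h : HasVertexRank P k a) (n : ℕ) :
    HasVertexRank P (k + n) (G.adjMatrixᵀ ^ n *ᵥ a) := by
  induction n with
  | zero => simpa using h
  | succ n ih =>
    rw [pow_succ', ← Matrix.mulVec_mulVec, Nat.cast_succ, ← add_assoc]
    exact ih.succ hG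

theorem prod (hG : G.NoSinks) : HasVertexRank P k a → HasVertexRank Q k b →
    HasVertexRank (P.prod Q) k (a + b) := by
  rintro ⟨ι, _, F, g, hg, rfl⟩ ⟨κ, _, F', g', hg', rfl⟩
  refine ⟨ι ⊕ κ, inferInstance, F.prod F', .fromBlocks g 0 0 g', ?_, ?_⟩
  · rw [F.gram_prod, hg, hg', Matrix.fromBlocks_map, Matrix.map_zero _ (map_zero _),
      Matrix.map_zero _ (map_zero _)]
  · exact pointwiseRank_fromBlocks (isIdempotentElem_of_gram_eq_map_diagHom hG hg)
      (isIdempotentElem_of_gram_eq_map_diagHom hG hg')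

theorem shift {δ l : ℤ} (h : δ + l = k) : HasVertexRank P k a → HasVertexRank (P.shift δ) l a :=
  fun ⟨ι, hι, F, g, hg, ha⟩ => ⟨ι, hι, F.shift h, g, hg, ha⟩

theorem of_isIso (hPQ : P.IsIso Q) : HasVertexRank P k a → HasVertexRank Q k a := by
  rintro ⟨ι, hι, F, g, hg, ha⟩
  obtain ⟨e, he⟩ := hPQ
  refine ⟨ι, hι, F.retract e.symm.toLinearMap e.toLinearMap (isGradedHom_symm e he) he
    (LinearMap.ext e.apply_symm_apply), g, ?_, ha⟩
  rw [← hg]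
  ext i j
  exact congrArg (F.coord i) (e.symm_apply_apply _)

theorem isIso (hG : G.NoSinks) : HasVertexRank P k a → HasVertexRank Q k a → P.IsIso Q := by
  rintro ⟨ι, _, F, g, hg, rfl⟩ ⟨κ, _, F', g', hg', h⟩
  exact F.isIso_of_mvNEquiv F' (diagHom_mem_grading K G) hg hg'
    (.of_pointwiseRank_eq (isIdempotentElem_of_gram_eq_map_diagHom hG hg)
      (isIdempotentElem_of_gram_eq_map_diagHom hG hg') h.symm)

theorem exists_pow_mulVec_eq (hG : G.NoSinks) : HasVertexRank P k a → HasVertexRank P k b →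
    ∃ n : ℕ, G.adjMatrixᵀ ^ n *ᵥ a = G.adjMatrixᵀ ^ n *ᵥ b := by
  rintro ⟨ι, _, F, g, hg, rfl⟩ ⟨κ, _, F', g', hg', rfl⟩
  obtain ⟨n, h, h'⟩ :=
    ((eventually_transition_mem_level F F').and (eventually_transition_mem_level F' F)).exists
  exact ⟨n, pow_mulVec_pointwiseRank_eq hG hg hg' h h'⟩

end HasVertexRank

end LPA

/-! ### Existence of vertex ranks -/

namespace LPA

open GrModule

variable {V : Type u} {E : Type v} [Fintype V] [Fintype E] [DecidableEq V]
variable {K : Type w} [Field K] {G : DirectedGraph V E} {P : GrModule (grading K G)} {k : ℤ}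

theorem exists_hasVertexRank_of_gram_mem_level {ι : Type (max u v w)} [Fintype ι] (hG : G.NoSinks)
    (F : P.Frame k ι) {n : ℕ} (h : ∀ i j, F.gram i j ∈ level K G n n) :
    ∃ a, HasVertexRank P (k + n) a := by
  induction n generalizing k ι with
  | zero =>
    choose g hg using fun i j => mem_level_zero.1 (h i j)
    rw [Nat.cast_zero, add_zero]
    exact ⟨_, ι, inferInstance, F, .of g, Matrix.ext fun i j => (hg i j).symm, rfl⟩
  | succ n ih =>
    rw [Nat.cast_succ, add_comm (n : ℤ), ← add_assoc]
    exact ih (edgeRefine hG F) (edgeRefine_transition_mem_level hG F F h)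

theorem exists_hasVertexRank (hG : G.NoSinks) (hP : P.IsFG) (hproj : P.IsGradedProjective) :
    ∃ (k : ℕ) (a : V → ℤ), HasVertexRank P k a := by
  have hspan := hP.eventually_span_deg_eq_top
    (P.monotone_span_deg (ed_mem_grading K G) (sum_ed_mul_gh K hG))
  obtain ⟨k, hk₀, hk⟩ := ((Filter.eventually_ge_atTop 0).and hspan).exists
  lift k to ℕ using hk₀
  obtain ⟨s, ⟨F⟩⟩ := exists_frame_of_span_deg_eq_top hP hproj hk
  obtain ⟨n, hn⟩ := (eventually_transition_mem_level F F).exists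
  exact ⟨k + n, exists_hasVertexRank_of_gram_mem_level hG F hn⟩

theorem exists_hasVertexRank_of_nonneg (k : ℤ) {a : V → ℤ} (ha : 0 ≤ a) :
    ∃ P : GrModule (grading K G), P.IsFG ∧ P.IsGradedProjective ∧ HasVertexRank P k a := by
  classical
  let ι := Σ v, ULift.{max v w} (Fin (a v).toNat)
  let g : Matrix ι ι (V → K) := .diagonal fun i => Pi.single i.1 1
  have hg : IsIdempotentElem g := by
    simp only [g, IsIdempotentElem, Matrix.diagonal_mul_diagonal, ← Pi.single_mul, mul_one]
  obtain ⟨P, F, hF⟩ := exists_frame_gram_eq (𝒜 := grading K G) k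
    (isIdempotentElem_matrix_map hg (diagHom K G : (V → K) →+* LPA K G))
    fun _ _ => diagHom_mem_grading K G _
  refine ⟨P, F.isFG, F.isGradedProjective, ι, inferInstance, F, g, hF, ?_⟩
  ext v
  have hfiber : Fintype.card {i : ι // i.1 = v} = (a v).toNat := by
    rw [Fintype.card_congr (Equiv.sigmaSubtype v), Fintype.card_ulift, Fintype.card_fin]
  have hne (i : ι) : (Pi.single i.1 1 : V → K) v ≠ 0 ↔ i.1 = v := by simp [Pi.single_apply, eq_comm]
  rw [pointwiseRank_diagonal, Fintype.card_congr (Equiv.subtypeEquivRight hne), hfiber,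
    Int.toNat_of_nonneg (ha v)]

end LPA

/-! ### The class of a graded module in Krieger's dimension group -/

namespace KriegerGroup

variable {n : Type u} [Fintype n] [DecidableEq n] (A : Matrix n n ℤ)

theorem mk_add_pow_mulVec (k m : ℕ) (a : n → ℤ) : mk A (k + m) (A ^ m *ᵥ a) = mk A k a := by
  induction m with
  | zero => simp
  | succ m ih => rw [pow_succ', ← Matrix.mulVec_mulVec, ← add_assoc, mk_succ_mulVec, ih]

instance : DirectedSystem (fun _ : ℕ => n → ℤ) fun i j h => stationaryMap A i j h where
  map_self i a := by
    change A ^ (i - i) *ᵥ a = a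
    rw [Nat.sub_self, pow_zero, Matrix.one_mulVec]
  map_map k j i hij hjk a := by
    change A ^ (k - j) *ᵥ A ^ (j - i) *ᵥ a = A ^ (k - i) *ᵥ a
    rw [Matrix.mulVec_mulVec, ← pow_add, Nat.sub_add_sub_cancel hjk hij]

theorem mk_eq_mk_iff {k : ℕ} {a b : n → ℤ} :
    mk A k a = mk A k b ↔ ∃ m : ℕ, A ^ m *ᵥ a = A ^ m *ᵥ b := by
  refine ⟨fun h => ?_, fun ⟨m, hm⟩ => ?_⟩
  · have hab : mk A k (a - b) = 0 := by rw [map_sub, h, sub_self]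
    obtain ⟨j, _, hzero⟩ := AddCommGroup.DirectLimit.of.zero_exact
      (G := fun _ : ℕ => n → ℤ) (f := stationaryMap A) k (a - b) hab
    refine ⟨j - k, sub_eq_zero.1 ?_⟩
    rw [← Matrix.mulVec_sub]
    exact hzero
  · rw [← mk_add_pow_mulVec A k m, hm, mk_add_pow_mulVec]

end KriegerGroup

namespace LPA

open KriegerGroup

variable {V : Type u} {E : Type v} [Fintype V] [Fintype E] [DecidableEq V]
variable {K : Type w} [Field K] {G : DirectedGraph V E}

theorem HasVertexRank.exists_common_degree (hG : G.NoSinks) {P Q : GrModule (grading K G)}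
    {k l : ℕ} {a b : V → ℤ} (h : HasVertexRank P k a) (h' : HasVertexRank Q l b) :
    ∃ (m : ℕ) (a' b' : V → ℤ), HasVertexRank P m a' ∧ HasVertexRank Q m b' ∧
      mk G.adjMatrixᵀ k a = mk G.adjMatrixᵀ m a' ∧ mk G.adjMatrixᵀ l b = mk G.adjMatrixᵀ m b' := by
  have hP := h.add_nat hG l
  have hQ := h'.add_nat hG k
  rw [← Nat.cast_add] at hP hQ
  rw [add_comm l k] at hQ
  refine ⟨k + l, _, _, hP, hQ, (mk_add_pow_mulVec _ k l a).symm, ?_⟩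
  rw [add_comm k l, mk_add_pow_mulVec]

theorem HasVertexRank.isIso_iff_mk_eq_mk (hG : G.NoSinks) {P Q : GrModule (grading K G)} {k l : ℕ}
    {a b : V → ℤ} (h : HasVertexRank P k a) (h' : HasVertexRank Q l b) :
    P.IsIso Q ↔ mk G.adjMatrixᵀ k a = mk G.adjMatrixᵀ l b := by
  obtain ⟨m, a', b', hP, hQ, ha, hb⟩ := h.exists_common_degree hG h'
  rw [ha, hb, mk_eq_mk_iff]
  refine ⟨fun hPQ => (hP.of_isIso hPQ).exists_pow_mulVec_eq hG hQ, fun ⟨j, hj⟩ => ?_⟩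
  have hP' := hP.add_nat hG j
  rw [hj] at hP'
  exact hP'.isIso hG (hQ.add_nat hG j)

/-- The class in Krieger's dimension group of a graded finitely generated projective module: it is
`[a, k]` if the module has ranks `a` with respect to generators of degree `k`. -/
noncomputable def kriegerClass (hG : G.NoSinks) (P : PgrModule (grading K G)) :
    KriegerGroup G.adjMatrixᵀ :=
  have h := exists_hasVertexRank hG P.2.1 P.2.2
  mk _ h.choose h.choose_spec.choose

theorem HasVertexRank.kriegerClass_eq (hG : G.NoSinks) {P : PgrModule (grading K G)} {k : ℕ}
    {a : V → ℤ} (h : HasVertexRank P.1 k a) : kriegerClass hG P = mk G.adjMatrixᵀ k a :=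
  have hP := (exists_hasVertexRank hG P.2.1 P.2.2).choose_spec.choose_spec
  (hP.isIso_iff_mk_eq_mk hG h).1 (.refl _)

theorem kriegerClass_eq_iff (hG : G.NoSinks) (P Q : PgrModule (grading K G)) :
    kriegerClass hG P = kriegerClass hG Q ↔ P.1.IsIso Q.1 :=
  ((exists_hasVertexRank hG P.2.1 P.2.2).choose_spec.choose_spec.isIso_iff_mk_eq_mk hG
    (exists_hasVertexRank hG Q.2.1 Q.2.2).choose_spec.choose_spec).symm

theorem kriegerClass_prod (hG : G.NoSinks) (P Q : PgrModule (grading K G)) :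
    kriegerClass hG ⟨P.1.prod Q.1, P.2.1.prod Q.2.1, P.2.2.prod Q.2.2⟩ =
      kriegerClass hG P + kriegerClass hG Q := by
  obtain ⟨k, a, hP⟩ := exists_hasVertexRank hG P.2.1 P.2.2
  obtain ⟨l, b, hQ⟩ := exists_hasVertexRank hG Q.2.1 Q.2.2
  obtain ⟨m, a', b', hP, hQ, -, -⟩ := hP.exists_common_degree hG hQ
  rw [hP.kriegerClass_eq hG, hQ.kriegerClass_eq hG, ← map_add]
  exact HasVertexRank.kriegerClass_eq hG (hP.prod hG hQ)

theorem kriegerClass_shift_one (hG : G.NoSinks) (P : PgrModule (grading K G)) :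
    kriegerClass hG ⟨P.1.shift 1, P.2.1.shift 1, P.2.2.shift 1⟩ =
      delta G.adjMatrixᵀ (kriegerClass hG P) := by
  obtain ⟨k, a, h⟩ := exists_hasVertexRank hG P.2.1 P.2.2
  have hshift : HasVertexRank (P.1.shift 1) k (G.adjMatrixᵀ *ᵥ a) :=
    (h.succ hG).shift (add_comm 1 (k : ℤ))
  rw [h.kriegerClass_eq hG]
  exact (HasVertexRank.kriegerClass_eq hG hshift).trans (deltaHom_mk _ k a).symm

/-- The map `[P] ↦ kriegerClass P` from `𝒱^gr(L_K(E))` to Krieger's dimension group. -/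
noncomputable def vgrToKrieger (hG : G.NoSinks) :
    Vgr (grading K G) →+ KriegerGroup G.adjMatrixᵀ :=
  AddMonoidHom.mk' (Quotient.lift (kriegerClass hG) fun P Q => (kriegerClass_eq_iff hG P Q).2)
    (by
      rintro ⟨P⟩ ⟨Q⟩
      exact kriegerClass_prod hG P Q)

theorem vgrToKrieger_mk (hG : G.NoSinks) (P : PgrModule (grading K G)) :
    vgrToKrieger hG (Vgr.mk P) = kriegerClass hG P := rfl

theorem vgrToKrieger_injective (hG : G.NoSinks) :
    Function.Injective (vgrToKrieger (K := K) hG) := by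
  rintro ⟨P⟩ ⟨Q⟩ h
  exact Vgr.sound ((kriegerClass_eq_iff hG P Q).1 h)

theorem range_vgrToKrieger (hG : G.NoSinks) :
    Set.range (vgrToKrieger (K := K) hG) = posCone G.adjMatrixᵀ := by
  ext z
  constructor
  · rintro ⟨⟨P⟩, rfl⟩
    obtain ⟨k, a, h⟩ := exists_hasVertexRank hG P.2.1 P.2.2
    exact ⟨k, a, h.nonneg, h.kriegerClass_eq hG⟩
  · rintro ⟨k, a, ha, rfl⟩
    obtain ⟨P, hP, hP', h⟩ := exists_hasVertexRank_of_nonneg (K := K) (G := G) k ha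
    exact ⟨Vgr.mk ⟨P, hP, hP'⟩, HasVertexRank.kriegerClass_eq hG h⟩

end LPA

/-! ### The isomorphism -/

theorem bijective_grothendieckAddGroup_lift {M H : Type*} [AddCommMonoid M] [AddCommGroup H]
    {f : M →+ H} (hf : Function.Injective f) (hsub : ∀ z, ∃ x y, f x - f y = z) :
    Function.Bijective (Algebra.GrothendieckAddGroup.lift f) := by
  have lift_of (x : M) :
      Algebra.GrothendieckAddGroup.lift f (Algebra.GrothendieckAddGroup.of x) = f x :=
    DFunLike.congr_fun (Algebra.GrothendieckAddGroup.lift.symm_apply_apply f) x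
  refine ⟨(injective_iff_map_eq_zero _).2 fun z hz => ?_, fun z => ?_⟩
  · obtain ⟨⟨x, y, _⟩, hxy : z + Algebra.GrothendieckAddGroup.of y = .of x⟩ :=
      (AddLocalization.addMonoidOf (⊤ : AddSubmonoid M)).surj z
    have hfxy := congrArg (Algebra.GrothendieckAddGroup.lift f) hxy
    rw [map_add, hz, zero_add, lift_of, lift_of] at hfxy
    rwa [hf hfxy, add_eq_right] at hxy
  · obtain ⟨x, y, rfl⟩ := hsub z
    exact ⟨.of x - .of y, by rw [map_sub, lift_of, lift_of]⟩

theorem KriegerGroup.exists_posCone_sub_eq {n : Type u} [Fintype n] [DecidableEq n]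
    (A : Matrix n n ℤ) (z : KriegerGroup A) : ∃ x ∈ posCone A, ∃ y ∈ posCone A, x - y = z := by
  induction z using AddCommGroup.DirectLimit.induction_on with
  | ih k a =>
    refine ⟨mk A k a⁺, ⟨k, a⁺, posPart_nonneg a, rfl⟩,
      mk A k a⁻, ⟨k, a⁻, negPart_nonneg a, rfl⟩, ?_⟩
    rw [← map_sub, posPart_sub_negPart]
    rfl

namespace LPA

variable {V : Type u} {E : Type v} [Fintype V] [Fintype E] [DecidableEq V]
variable {K : Type w} [Field K] {G : DirectedGraph V E}

/-- The isomorphism from `K₀^gr(L_K(E))` to Krieger's dimension group extending `vgrToKrieger`. -/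
noncomputable def k0grEquivKrieger (hG : G.NoSinks) :
    K0gr (grading K G) ≃+ KriegerGroup G.adjMatrixᵀ :=
  .ofBijective (Algebra.GrothendieckAddGroup.lift (vgrToKrieger hG)) <|
    bijective_grothendieckAddGroup_lift (vgrToKrieger_injective hG) fun z => by
      obtain ⟨x, hx, y, hy, h⟩ := KriegerGroup.exists_posCone_sub_eq _ z
      rw [← range_vgrToKrieger (K := K) hG] at hx hy
      obtain ⟨p, rfl⟩ := hx
      obtain ⟨q, rfl⟩ := hy
      exact ⟨p, q, h⟩

theorem k0grEquivKrieger_of (hG : G.NoSinks) (p : Vgr (grading K G)) :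
    k0grEquivKrieger hG (K0gr.of p) = vgrToKrieger hG p :=
  DFunLike.congr_fun (Algebra.GrothendieckAddGroup.lift.symm_apply_apply (vgrToKrieger hG)) p

theorem k0grEquivKrieger_T_smul (hG : G.NoSinks) (α : K0gr (grading K G)) :
    k0grEquivKrieger hG ((LaurentPolynomial.T 1 : ℤ[T;T⁻¹]) • α) =
      KriegerGroup.delta G.adjMatrixᵀ (k0grEquivKrieger hG α) := by
  let φ := (k0grEquivKrieger (K := K) hG).toAddMonoidHom
  suffices h : φ.comp (DistribSMul.toAddMonoidHom _ (LaurentPolynomial.T 1 : ℤ[T;T⁻¹])) =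
      (KriegerGroup.delta G.adjMatrixᵀ).toAddMonoidHom.comp φ from DFunLike.congr_fun h α
  refine K0gr.hom_ext ?_
  rintro ⟨P⟩
  change k0grEquivKrieger hG ((AddMonoidAlgebra.single 1 1 : AddMonoidAlgebra ℤ ℤ) •
    K0gr.of (Vgr.mk P)) = KriegerGroup.delta _ (k0grEquivKrieger hG (K0gr.of (Vgr.mk P)))
  rw [K0gr.single_smul_of_mk, k0grEquivKrieger_of, k0grEquivKrieger_of, vgrToKrieger_mk]
  exact kriegerClass_shift_one hG P

theorem image_k0grEquivKrieger_posCone (hG : G.NoSinks) :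
    k0grEquivKrieger hG '' K0gr.posCone (grading K G) = KriegerGroup.posCone G.adjMatrixᵀ := by
  rw [K0gr.posCone, ← Set.range_comp, ← range_vgrToKrieger (K := K) hG]
  exact congrArg Set.range (funext (k0grEquivKrieger_of hG))

end LPA

theorem mainTheorem7 {V : Type u} {E : Type v} [Fintype V] [Fintype E] [DecidableEq V]
    (G : DirectedGraph V E) (hG : G.NoSinks) (K : Type w) [Field K] :
    ∃ φ : K0gr (LPA.grading K G) ≃+ KriegerGroup (G.adjMatrixᵀ),
      (∀ α : K0gr (LPA.grading K G),
        φ ((LaurentPolynomial.T 1 : ℤ[T;T⁻¹]) • α) = KriegerGroup.delta (G.adjMatrixᵀ) (φ α)) ∧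
      φ '' K0gr.posCone (LPA.grading K G) = KriegerGroup.posCone (G.adjMatrixᵀ) :=
  ⟨LPA.k0grEquivKrieger hG, LPA.k0grEquivKrieger_T_smul hG, LPA.image_k0grEquivKrieger_posCone hG⟩
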